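/- Let $0<q<1$. For $Y\in\{\widetilde X,\widetilde\Xi\}$ let $\mathrm{Pol}(Y)_q$ be the unital $\mathbb C$-algebra with generators $t_{11},t_{12},t_{21},t_{22}$ and relations $t_{11}t_{12}=qt_{12}t_{11}$, $t_{21}t_{22}=qt_{22}t_{21}$, $t_{11}t_{21}=qt_{21}t_{11}$, $t_{12}t_{22}=qt_{22}t_{12}$, $t_{12}t_{21}=t_{21}t_{12}$, $t_{11}t_{22}-t_{22}t_{11}=(q-q^{-1})t_{12}t_{21}$ and $t_{11}t_{22}-qt_{12}t_{21}=c$, where $c=1$ for $\widetilde X$ and $c=0$ for $\widetilde\Xi$. Put $t_{11}^*=-t_{22}$, $t_{12}^*=-qt_{21}$, $x=t_{12}t_{12}^*$. Every $f\in\mathrm{Pol}(Y)_q$ has a unique (finite) decomposition $$f=\sum t_{11}^{i_1}t_{12}^{i_2}\,\psi_{i_1i_2j_1j_2}(x)\,t_{12}^{*j_2}t_{11}^{*j_1},\qquad i_1j_1=i_2j_2=0,$$ with polynomials $\psi_{i_1i_2j_1j_2}$. Let $\mathrm{Pol}(Y_1\times Y_2)_q=\mathrm{Pol}(Y_1)_q^{\rm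 op}\otimes\mathrm{Pol}(Y_2)_q$, and write $t_{ij}=t_{ij}\otimes1$, $\tau_{ij}=1\otimes t_{ij}$. The space of distributions $D(Y_1\times Y_2)_q'$ is the completion of $\mathrm{Pol}(Y_1\times Y_2)_q$ in the weakest topology for which the tensor products of the functionals $f\mapsto\psi_{i_1i_2j_1j_2}(a)$ are continuous, where $a\in q^{-2\mathbb Z_+}$ for a factor $\widetilde X$ and $a\in q^{2\mathbb Z}$ for a factor $\widetilde\Xi$; that is, it is the space of formal series as above in both factors, with arbitrary functions on the product of the two progressions as coefficients, and with the topology of pointwise convergence of the coefficients. It is a $\mathrm{Pol}(Y_1\times Y_2)_q$-bimodule by continuity. The finite functions $D(Y_1\times Y_2)_q$ are the distributions with only finitely many nonzero coefficient values. Let $\int f\,d\nu=(1-q^2)\sum_{m}\psi_{0000}(q^{-2m})q^{-2m}$ (the sum over $m\in\mathbb Z_+$ for $\widetilde X$, $m\in\mathbb Z$ for $\widetilde\Xi$), and let $\iint f\psi\,d\nu_1d\nu_2$ be the resulting pairing of a distribution $f$ with a finite function $\psi$, extended by continuity from polynomial $f$. A function $f:\mathbb C\setminus\{0\}\to D(Y_1\times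 Y_2)_q'$ is called a polynomial vector-function if for every finite function $\psi$ the function $\lambda\mapsto\iint f(\lambda)\psi\,d\nu_1d\nu_2$ belongs to $\mathbb C[\lambda,\lambda^{-1}]$. Let $k_{11}=t_{11}\tau_{22}-qt_{12}\tau_{21}$. **Proposition.** For each of the three spaces $D(\widetilde X\times\widetilde X)_q'$, $D(\widetilde X\times\widetilde\Xi)_q'$, $D(\widetilde\Xi\times\widetilde X)_q'$ the following holds. The elements $t_{12}$, $\tau_{21}$ and $(-qt_{12}\tau_{21})^l$, $l\in\mathbb Z_+$, act on distributions bijectively by left multiplication. For every $l\in\mathbb Z_+$ there is a unique distribution $k_{11}^{-l}$ with $k_{11}^l\,k_{11}^{-l}=1=k_{11}^{-l}\,k_{11}^l$. There exists a unique polynomial vector-function $f(\lambda)$ such that for all $l\in\mathbb Z_+$ $$k_{11}^{-l}=(-qt_{12}\tau_{21})^{-l}f(q^{2l}).$$ Explicitly, with $z=qt_{12}^{-1}t_{11}$, $\zeta^*=\tau_{21}^{-1}\tau_{22}$ and $(a;q^2)_n=\prod_{j=0}^{n-1}(1-aq^{2j})$, $$f(\lambda)=\sum_{n=0}^\infty\frac{(\lambda;q^2)_n}{(q^2;q^2)_n}(z\zeta^*)^n\qquad(\lambda\in\mathbb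 C\setminus\{0\}),$$ the series being convergent in the space of distributions. -/

import Mathlib

open Filter Topology Polynomial TensorProduct

namespace QSU

/-- The two quantum spaces on which kernels live: the principal homogeneous space `X̃`
and the cone `Ξ̃`. -/
inductive QSpace
  | principal
  | cone

/-- The right-hand side of `t₁₁t₂₂ - q t₁₂t₂₁ = c`: it is `1` for `X̃` and `0` for `Ξ̃`. -/
def QSpace.det : QSpace → ℂ
  | .principal => 1
  | .cone => 0

/-- The deformation parameter, `0 < q < 1`. -/
structure QParam where
  val : ℝ
  pos : 0 < val
  lt_one : val < 1

/-- `q` as a complex number. -/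
noncomputable def QParam.c (q : QParam) : ℂ := (q.val : ℂ)

theorem QParam.c_ne_zero (q : QParam) : q.c ≠ 0 := by
  have := q.pos.ne'
  simpa [QParam.c] using this

/-- The four generators `t_{ij}`. -/
inductive Gen
  | t11
  | t12
  | t21
  | t22

section Pol

local notation "τ" => FreeAlgebra.ι ℂ (X := Gen)

/-- The defining relations of `Pol(X̃)_q` and `Pol(Ξ̃)_q`. -/
inductive Rel (q : QParam) (Y : QSpace) : FreeAlgebra ℂ Gen → FreeAlgebra ℂ Gen → Prop
  | r1 : Rel q Y (τ .t11 * τ .t12) (q.c • (τ .t12 * τ .t11))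
  | r2 : Rel q Y (τ .t21 * τ .t22) (q.c • (τ .t22 * τ .t21))
  | r3 : Rel q Y (τ .t11 * τ .t21) (q.c • (τ .t21 * τ .t11))
  | r4 : Rel q Y (τ .t12 * τ .t22) (q.c • (τ .t22 * τ .t12))
  | r5 : Rel q Y (τ .t12 * τ .t21) (τ .t21 * τ .t12)
  | r6 : Rel q Y (τ .t11 * τ .t22 - τ .t22 * τ .t11) ((q.c - q.c⁻¹) • (τ .t12 * τ .t21))
  | r7 : Rel q Y (τ .t11 * τ .t22 - q.c • (τ .t12 * τ .t21))
      (algebraMap ℂ (FreeAlgebra ℂ Gen) Y.det)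

end Pol

/-- The algebra `Pol(Y)_q`, `Y ∈ {X̃, Ξ̃}`, by generators and relations. -/
def Pol (q : QParam) (Y : QSpace) := RingQuot (Rel q Y)

variable (q : QParam) (Y : QSpace)

noncomputable instance : Ring (Pol q Y) := inferInstanceAs (Ring (RingQuot (Rel q Y)))

noncomputable instance : Algebra ℂ (Pol q Y) :=
  inferInstanceAs (Algebra ℂ (RingQuot (Rel q Y)))

/-- The quotient map from the free algebra. -/
noncomputable def Pol.mk : FreeAlgebra ℂ Gen →ₐ[ℂ] Pol q Y := RingQuot.mkAlgHom ℂ (Rel q Y)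

/-- The generators `t_{ij}` of `Pol(Y)_q`. -/
noncomputable def gen (g : Gen) : Pol q Y := Pol.mk q Y (FreeAlgebra.ι ℂ g)

/-- `t₁₁^* = -t₂₂`. -/
noncomputable def t11s : Pol q Y := -gen q Y .t22

/-- `t₁₂^* = -q t₂₁`. -/
noncomputable def t12s : Pol q Y := -(q.c • gen q Y .t21)

/-- `x = t₁₂ t₁₂^*`. -/
noncomputable def xel : Pol q Y := gen q Y .t12 * t12s q Y

/-- The index set `M'' = {(i₁,i₂,j₁,j₂) ∈ ℤ₊⁴ | i₁j₁ = i₂j₂ = 0}`. -/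
@[ext] structure MIdx where
  i1 : ℕ
  i2 : ℕ
  j1 : ℕ
  j2 : ℕ
  h1 : i1 * j1 = 0
  h2 : i2 * j2 = 0

/-- The index `(0,0,0,0)`. -/
def MIdx.zero : MIdx := ⟨0, 0, 0, 0, rfl, rfl⟩

/-- `ψ ↦ t₁₁^{i₁} t₁₂^{i₂} ψ(x) t₁₂^{*j₂} t₁₁^{*j₁}`. -/
noncomputable def monomialMap (i1 i2 j2 j1 : ℕ) : ℂ[X] →ₗ[ℂ] Pol q Y :=
  LinearMap.mulRight ℂ (t11s q Y ^ j1) ∘ₗ LinearMap.mulRight ℂ (t12s q Y ^ j2) ∘ₗ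
    LinearMap.mulLeft ℂ (gen q Y .t11 ^ i1 * gen q Y .t12 ^ i2) ∘ₗ
    (Polynomial.aeval (xel q Y)).toLinearMap

theorem monomialMap_apply (i1 i2 j2 j1 : ℕ) (P : ℂ[X]) :
    monomialMap q Y i1 i2 j2 j1 P = gen q Y .t11 ^ i1 * gen q Y .t12 ^ i2 *
      Polynomial.aeval (xel q Y) P * t12s q Y ^ j2 * t11s q Y ^ j1 := rfl

/-- `(ψ_i)_{i ∈ M''} ↦ ∑ t₁₁^{i₁} t₁₂^{i₂} ψ_{i₁i₂j₁j₂}(x) t₁₂^{*j₂} t₁₁^{*j₁}`. -/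
noncomputable def normalForm : (MIdx →₀ ℂ[X]) →ₗ[ℂ] Pol q Y :=
  Finsupp.lsum ℂ fun i => monomialMap q Y i.i1 i.i2 i.j2 i.j1

/-! ### Existence and uniqueness of the decomposition -/

section Span

theorem rel_of {a b : FreeAlgebra ℂ Gen} (h : Rel q Y a b) :
    Pol.mk q Y a = Pol.mk q Y b :=
  RingQuot.mkAlgHom_rel ℂ h

theorem e1 : gen q Y .t11 * gen q Y .t12 = q.c • (gen q Y .t12 * gen q Y .t11) := by
  simpa [gen] using rel_of q Y Rel.r1
theorem e2 : gen q Y .t21 * gen q Y .t22 = q.c • (gen q Y .t22 * gen q Y .t21) := by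
  simpa [gen] using rel_of q Y Rel.r2
theorem e3 : gen q Y .t11 * gen q Y .t21 = q.c • (gen q Y .t21 * gen q Y .t11) := by
  simpa [gen] using rel_of q Y Rel.r3
theorem e4 : gen q Y .t12 * gen q Y .t22 = q.c • (gen q Y .t22 * gen q Y .t12) := by
  simpa [gen] using rel_of q Y Rel.r4
theorem e5 : gen q Y .t12 * gen q Y .t21 = gen q Y .t21 * gen q Y .t12 := by
  simpa [gen] using rel_of q Y Rel.r5
theorem e6 : gen q Y .t11 * gen q Y .t22 - gen q Y .t22 * gen q Y .t11 =
    (q.c - q.c⁻¹) • (gen q Y .t12 * gen q Y .t21) := by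
  have h := rel_of q Y Rel.r6
  rw [map_sub, map_smul, map_mul, map_mul, map_mul] at h
  exact h
theorem e7 : gen q Y .t11 * gen q Y .t22 - q.c • (gen q Y .t12 * gen q Y .t21) =
    algebraMap ℂ _ Y.det := by
  have h := rel_of q Y Rel.r7
  rw [map_sub, map_smul, map_mul, map_mul, AlgHom.commutes] at h
  exact h

theorem t12_t11 : gen q Y .t12 * gen q Y .t11 = q.c⁻¹ • (gen q Y .t11 * gen q Y .t12) := by
  rw [e1, smul_smul, inv_mul_cancel₀ q.c_ne_zero, one_smul]

theorem t12s_t11 : t12s q Y * gen q Y .t11 = q.c⁻¹ • (gen q Y .t11 * t12s q Y) := by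
  simp only [t12s, mul_neg, neg_mul, mul_smul_comm, smul_mul_assoc, e3, smul_neg]
  rw [smul_smul q.c⁻¹, inv_mul_cancel₀ q.c_ne_zero, one_smul]

theorem t12s_t12 : t12s q Y * gen q Y .t12 = gen q Y .t12 * t12s q Y := by
  simp only [t12s, mul_neg, neg_mul, mul_smul_comm, smul_mul_assoc, e5]

theorem t11s_t12 : t11s q Y * gen q Y .t12 = q.c⁻¹ • (gen q Y .t12 * t11s q Y) := by
  simp only [t11s, mul_neg, neg_mul, e4, smul_neg]
  rw [smul_smul, inv_mul_cancel₀ q.c_ne_zero, one_smul]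

theorem t11s_t12s : t11s q Y * t12s q Y = q.c⁻¹ • (t12s q Y * t11s q Y) := by
  simp only [t11s, t12s, mul_neg, neg_mul, neg_neg, mul_smul_comm, smul_mul_assoc, e2]
  rw [smul_smul q.c⁻¹, inv_mul_cancel₀ q.c_ne_zero, one_smul, smul_neg, neg_neg]

theorem t11_t11s : gen q Y .t11 * t11s q Y = xel q Y - algebraMap ℂ _ Y.det := by
  rw [← e7]
  simp only [t11s, t12s, xel, mul_neg, mul_smul_comm]
  abel

theorem t11s_t11 : t11s q Y * gen q Y .t11 =
    (q.c⁻¹ ^ 2) • xel q Y - algebraMap ℂ _ Y.det := by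
  have h6 := e6 q Y
  have h : gen q Y .t22 * gen q Y .t11 =
      gen q Y .t11 * gen q Y .t22 - (q.c - q.c⁻¹) • (gen q Y .t12 * gen q Y .t21) := by
    rw [← h6]; abel
  rw [← e7, t11s, neg_mul, h, xel, t12s]
  simp only [mul_neg, mul_smul_comm, smul_neg, smul_smul, sub_smul]
  rw [show q.c⁻¹ ^ 2 * q.c = q.c⁻¹ by
    rw [pow_two, mul_assoc, inv_mul_cancel₀ q.c_ne_zero, mul_one]]
  abel

theorem t11_x : gen q Y .t11 * xel q Y = (q.c ^ 2 • xel q Y) * gen q Y .t11 := by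
  have h := t12s_t11 q Y
  have h' : gen q Y .t11 * t12s q Y = q.c • (t12s q Y * gen q Y .t11) := by
    rw [h, smul_smul, mul_inv_cancel₀ q.c_ne_zero, one_smul]
  rw [xel, ← mul_assoc, e1, smul_mul_assoc, mul_assoc, h', mul_smul_comm, smul_smul,
    smul_mul_assoc, pow_two, mul_assoc]

theorem t11s_x : t11s q Y * xel q Y = (q.c⁻¹ ^ 2 • xel q Y) * t11s q Y := by
  rw [xel, ← mul_assoc, t11s_t12, smul_mul_assoc, mul_assoc, t11s_t12s, mul_smul_comm,
    smul_smul, smul_mul_assoc, pow_two, mul_assoc]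

theorem t12_x : gen q Y .t12 * xel q Y = xel q Y * gen q Y .t12 := by
  rw [xel, mul_assoc, t12s_t12]

theorem t12s_x : t12s q Y * xel q Y = xel q Y * t12s q Y := by
  rw [xel, ← mul_assoc, t12s_t12]

/-- If `a x = (s x) a` then `a P(x) = P(s x) a`. -/
theorem comm_aeval {a : Pol q Y} {s : ℂ} (h : a * xel q Y = (s • xel q Y) * a) (P : ℂ[X]) :
    a * aeval (xel q Y) P = aeval (xel q Y) (P.comp (C s * X)) * a := by
  induction P using Polynomial.induction_on with
  | C r => simp [Algebra.commutes]
  | add f g hf hg => simp [mul_add, add_mul, hf, hg]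
  | monomial n r ih =>
    rw [pow_succ, ← mul_assoc, map_mul, ← mul_assoc, ih, aeval_X, mul_assoc, h, ← mul_assoc]
    congr 1
    simp only [mul_comp, C_comp, pow_comp, X_comp, map_mul, aeval_C, aeval_X, map_pow,
      Algebra.smul_def]

theorem comm_pow {a b : Pol q Y} {s : ℂ} (h : a * b = s • (b * a)) (n : ℕ) :
    a * b ^ n = s ^ n • (b ^ n * a) := by
  induction n with
  | zero => simp
  | succ n ih =>
    rw [pow_succ, ← mul_assoc, ih, smul_mul_assoc, mul_assoc, h, mul_smul_comm, smul_smul,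
      mul_assoc, pow_succ]

/-- The image of the normal form map. -/
noncomputable def nfRange : Submodule ℂ (Pol q Y) := LinearMap.range (normalForm q Y)

theorem mono_mem_of (i1 i2 j2 j1 : ℕ) (h1 : i1 * j1 = 0) (h2 : i2 * j2 = 0) (P : ℂ[X]) :
    monomialMap q Y i1 i2 j2 j1 P ∈ nfRange q Y :=
  ⟨Finsupp.single ⟨i1, i2, j1, j2, h1, h2⟩ P, by simp [normalForm]⟩

theorem mono_red2 (i1 i2 j2 j1 : ℕ) (P : ℂ[X]) :
    monomialMap q Y i1 (i2 + 1) (j2 + 1) j1 P = monomialMap q Y i1 i2 j2 j1 (P * X) := by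
  have hP := comm_aeval q Y (a := gen q Y .t12) (s := 1) (by rw [one_smul, t12_x]) P
  rw [C_1, one_mul, comp_X] at hP
  simp only [monomialMap_apply, pow_succ (gen q Y .t12), pow_succ' (t12s q Y), map_mul, aeval_X]
  simp only [mul_assoc]
  congr 2
  rw [← mul_assoc (gen q Y .t12), hP, xel]
  simp only [mul_assoc]

theorem mono_red1 (i1 i2 j2 j1 : ℕ) (P : ℂ[X]) : ∃ Q : ℂ[X],
    monomialMap q Y (i1 + 1) i2 j2 (j1 + 1) P = monomialMap q Y i1 i2 j2 j1 Q := by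
  have hP := comm_aeval q Y (t11_x q Y) P
  have h12 := comm_pow q Y (e1 q Y) i2
  have h12s := comm_pow q Y (show gen q Y .t11 * t12s q Y = q.c • (t12s q Y * gen q Y .t11) by
    rw [t12s_t11, smul_smul, mul_inv_cancel₀ q.c_ne_zero, one_smul]) j2
  have hx : ∀ R : ℂ[X], t12s q Y ^ j2 * aeval (xel q Y) R =
      aeval (xel q Y) R * t12s q Y ^ j2 := fun R => by
    have hc : Commute (t12s q Y) (xel q Y) := t12s_x q Y
    have := hc.pow_left j2
    induction R using Polynomial.induction_on with
    | C r => simp [Algebra.commutes]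
    | add f g hf hg => simp [mul_add, add_mul, hf, hg]
    | monomial n r ih =>
      rw [pow_succ, ← mul_assoc, map_mul, ← mul_assoc, ih, aeval_X, mul_assoc, mul_assoc]
      congr 1
  refine ⟨C (q.c ^ i2 * q.c ^ j2) * (P.comp (C (q.c ^ 2) * X) * (X - C Y.det)), ?_⟩
  have hQ : aeval (xel q Y) (C (q.c ^ i2 * q.c ^ j2) *
      (P.comp (C (q.c ^ 2) * X) * (X - C Y.det))) = (q.c ^ i2 * q.c ^ j2) •
      (aeval (xel q Y) (P.comp (C (q.c ^ 2) * X)) * (xel q Y - algebraMap ℂ _ Y.det)) := by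
    rw [← smul_eq_C_mul, map_smul, map_mul, map_sub, aeval_X, aeval_C]
  have hx' := hx (X - C Y.det)
  rw [map_sub, aeval_X, aeval_C] at hx'
  have key : gen q Y .t11 * (gen q Y .t12 ^ i2 * (aeval (xel q Y) P * (t12s q Y ^ j2 *
      t11s q Y))) = (q.c ^ i2 * q.c ^ j2) • (gen q Y .t12 ^ i2 * (aeval (xel q Y)
      (P.comp (C (q.c ^ 2) * X)) * ((xel q Y - algebraMap ℂ _ Y.det) * t12s q Y ^ j2))) := by
    rw [← mul_assoc, h12, smul_mul_assoc, mul_assoc, ← mul_assoc (gen q Y .t11) (aeval _ _), hP,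
      mul_assoc (aeval _ _), ← mul_assoc (gen q Y .t11), h12s, smul_mul_assoc, mul_assoc,
      t11_t11s, hx']
    simp only [mul_smul_comm, smul_smul]
  simp only [monomialMap_apply, hQ, pow_succ (gen q Y .t11), pow_succ' (t11s q Y)]
  have key' := congrArg (fun y => gen q Y .t11 ^ i1 * (y * t11s q Y ^ j1)) key
  simp only [mul_assoc, mul_smul_comm, smul_mul_assoc] at key' ⊢
  exact key'

theorem mono_mem (i1 i2 j2 j1 : ℕ) (P : ℂ[X]) :
    monomialMap q Y i1 i2 j2 j1 P ∈ nfRange q Y := by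
  induction i2 generalizing j2 P with
  | succ i2 ih =>
    cases j2 with
    | succ j2 => rw [mono_red2]; exact ih _ _
    | zero =>
      clear ih
      induction i1 generalizing j1 P with
      | zero => exact mono_mem_of q Y _ _ _ _ (by simp) (by simp) P
      | succ i1 ih =>
        cases j1 with
        | zero => exact mono_mem_of q Y _ _ _ _ (by simp) (by simp) P
        | succ j1 => obtain ⟨Q, hQ⟩ := mono_red1 q Y i1 (i2 + 1) 0 j1 P; rw [hQ]; exact ih _ _
  | zero =>
    induction i1 generalizing j1 P with
    | zero => exact mono_mem_of q Y _ _ _ _ (by simp) (by simp) P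
    | succ i1 ih =>
      cases j1 with
      | zero => exact mono_mem_of q Y _ _ _ _ (by simp) (by simp) P
      | succ j1 => obtain ⟨Q, hQ⟩ := mono_red1 q Y i1 0 j2 j1 P; rw [hQ]; exact ih _ _

theorem t11_mono (i1 i2 j2 j1 : ℕ) (P : ℂ[X]) :
    gen q Y .t11 * monomialMap q Y i1 i2 j2 j1 P = monomialMap q Y (i1 + 1) i2 j2 j1 P := by
  simp only [monomialMap_apply, pow_succ' (gen q Y .t11), mul_assoc]

theorem t12_mono (i1 i2 j2 j1 : ℕ) (P : ℂ[X]) :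
    gen q Y .t12 * monomialMap q Y i1 i2 j2 j1 P =
      q.c⁻¹ ^ i1 • monomialMap q Y i1 (i2 + 1) j2 j1 P := by
  simp only [monomialMap_apply, ← mul_assoc, comm_pow q Y (t12_t11 q Y)]
  simp only [pow_succ' (gen q Y .t12), mul_assoc, smul_mul_assoc]

theorem t12s_mono (i1 i2 j2 j1 : ℕ) (P : ℂ[X]) :
    t12s q Y * monomialMap q Y i1 i2 j2 j1 P =
      q.c⁻¹ ^ i1 • monomialMap q Y i1 i2 (j2 + 1) j1 P := by
  have hP := comm_aeval q Y (a := t12s q Y) (s := 1) (by rw [one_smul, t12s_x]) P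
  rw [C_1, one_mul, comp_X] at hP
  have h12 : t12s q Y * gen q Y .t12 ^ i2 = gen q Y .t12 ^ i2 * t12s q Y :=
    Commute.pow_right (t12s_t12 q Y) i2
  simp only [monomialMap_apply, ← mul_assoc, comm_pow q Y (t12s_t11 q Y), smul_mul_assoc]
  congr 1
  rw [mul_assoc _ (t12s q Y) (gen q Y .t12 ^ i2), h12, ← mul_assoc,
    mul_assoc _ (t12s q Y) (aeval _ _), hP]
  simp only [pow_succ' (t12s q Y), mul_assoc]

theorem x_mono (i1 i2 j2 j1 : ℕ) (P : ℂ[X]) :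
    xel q Y * monomialMap q Y i1 i2 j2 j1 P ∈ nfRange q Y := by
  rw [xel, mul_assoc, t12s_mono, mul_smul_comm, t12_mono]
  exact Submodule.smul_mem _ _ (Submodule.smul_mem _ _ (mono_mem q Y _ _ _ _ _))

theorem t11s_mono (i1 i2 j2 j1 : ℕ) (P : ℂ[X]) :
    t11s q Y * monomialMap q Y i1 i2 j2 j1 P ∈ nfRange q Y := by
  cases i1 with
  | succ i1 =>
    rw [← t11_mono, ← mul_assoc, t11s_t11, sub_mul, smul_mul_assoc, ← Algebra.smul_def]
    exact Submodule.sub_mem _ (Submodule.smul_mem _ _ (x_mono q Y _ _ _ _ _))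
      (Submodule.smul_mem _ _ (mono_mem q Y _ _ _ _ _))
  | zero =>
    have hP := comm_aeval q Y (t11s_x q Y) P
    have h : t11s q Y * monomialMap q Y 0 i2 j2 j1 P = (q.c⁻¹ ^ i2 * q.c⁻¹ ^ j2) •
        monomialMap q Y 0 i2 j2 (j1 + 1) (P.comp (C (q.c⁻¹ ^ 2) * X)) := by
      simp only [monomialMap_apply, pow_zero, one_mul, ← mul_assoc,
        comm_pow q Y (t11s_t12 q Y), smul_mul_assoc]
      rw [mul_assoc _ (t11s q Y) (aeval _ _), hP, ← mul_assoc, mul_assoc _ (t11s q Y),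
        comm_pow q Y (t11s_t12s q Y)]
      simp only [pow_succ' (t11s q Y), mul_assoc, smul_smul, mul_smul_comm, smul_mul_assoc]
    rw [h]
    exact Submodule.smul_mem _ _ (mono_mem q Y _ _ _ _ _)

theorem gen_mul_mem (g : Gen) {p : Pol q Y} (hp : p ∈ nfRange q Y) :
    gen q Y g * p ∈ nfRange q Y := by
  obtain ⟨c, rfl⟩ := hp
  induction c using Finsupp.induction_linear with
  | zero => simp
  | add a b ha hb => rw [map_add, mul_add]; exact Submodule.add_mem _ ha hb
  | single i P =>
    rw [show normalForm q Y (Finsupp.single i P) = monomialMap q Y i.i1 i.i2 i.j2 i.j1 P by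
      simp [normalForm]]
    cases g with
    | t11 => rw [t11_mono]; exact mono_mem q Y _ _ _ _ _
    | t12 => rw [t12_mono]; exact Submodule.smul_mem _ _ (mono_mem q Y _ _ _ _ _)
    | t21 =>
      have h : gen q Y .t21 = (-q.c⁻¹) • t12s q Y := by
        rw [t12s, smul_neg, neg_smul, neg_neg, smul_smul, inv_mul_cancel₀ q.c_ne_zero, one_smul]
      rw [h, smul_mul_assoc, t12s_mono]
      exact Submodule.smul_mem _ _ (Submodule.smul_mem _ _ (mono_mem q Y _ _ _ _ _))
    | t22 =>
      have h : gen q Y .t22 = (-1 : ℂ) • t11s q Y := by simp [t11s]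
      rw [h, smul_mul_assoc]
      exact Submodule.smul_mem _ _ (t11s_mono q Y _ _ _ _ _)

theorem normalForm_surjective : Function.Surjective (normalForm q Y) := by
  have main : ∀ a : FreeAlgebra ℂ Gen, ∀ p ∈ nfRange q Y,
      Pol.mk q Y a * p ∈ nfRange q Y := by
    intro a
    induction a using FreeAlgebra.induction with
    | grade0 r =>
      intro p hp
      rw [AlgHom.commutes, ← Algebra.smul_def]
      exact Submodule.smul_mem _ _ hp
    | grade1 g => intro p hp; exact gen_mul_mem q Y g hp
    | mul a b ha hb => intro p hp; rw [map_mul, mul_assoc]; exact ha _ (hb _ hp)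
    | add a b ha hb =>
      intro p hp; rw [map_add, add_mul]; exact Submodule.add_mem _ (ha _ hp) (hb _ hp)
  intro p
  obtain ⟨a, rfl⟩ := RingQuot.mkAlgHom_surjective ℂ (Rel q Y) p
  have h1 : (1 : Pol q Y) ∈ nfRange q Y := by
    have := mono_mem q Y 0 0 0 0 1
    simpa [monomialMap_apply] using this
  have := main a 1 h1
  rwa [mul_one] at this

end Span

section Indep

/-- Auxiliary operators `t_{ij}` on functions on `ℤ × ℤ`. -/
noncomputable def opFun : Gen → Module.End ℂ (ℤ × ℤ → ℂ)
  | .t11 => LinearMap.pi fun a => LinearMap.proj (a.1 - 1, a.2)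
  | .t12 => LinearMap.pi fun a => q.c ^ (-a.1) • LinearMap.proj (a.1, a.2 - 1)
  | .t21 => LinearMap.pi fun a => (-(q.c⁻¹ * q.c ^ (-a.1))) • LinearMap.proj (a.1, a.2 + 1)
  | .t22 => LinearMap.pi fun a =>
      (Y.det - q.c ^ (-(a.1 + 1)) * q.c ^ (-(a.1 + 1))) • LinearMap.proj (a.1 + 1, a.2)

theorem opFun_rel ⦃a b : FreeAlgebra ℂ Gen⦄ (h : Rel q Y a b) :
    FreeAlgebra.lift ℂ (opFun q Y) a = FreeAlgebra.lift ℂ (opFun q Y) b := by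
  have hq := q.c_ne_zero
  have e : ∀ m : ℤ, q.c ^ (-(m - 1)) = q.c * q.c ^ (-m) := fun m => by
    rw [neg_sub, sub_eq_add_neg, zpow_add₀ hq, zpow_one]
  have e' : ∀ m : ℤ, q.c ^ (-(m + 1)) = q.c⁻¹ * q.c ^ (-m) := fun m => by
    rw [neg_add, zpow_add₀ hq, zpow_neg_one, mul_comm]
  cases h <;> refine LinearMap.ext fun g => funext fun ⟨m, p⟩ => ?_ <;>
    simp only [map_mul, map_sub, map_smul, FreeAlgebra.lift_ι_apply, AlgHom.commutes, opFun,
      Module.End.mul_apply, LinearMap.pi_apply, LinearMap.smul_apply, LinearMap.proj_apply,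
      LinearMap.sub_apply, Pi.smul_apply, Pi.sub_apply, smul_eq_mul, e, e',
      Module.algebraMap_end_apply, sub_add_cancel, add_sub_cancel_right] <;>
    generalize q.c ^ (-m) = w <;> field_simp <;> ring

/-- Auxiliary representation of `Pol(Y)_q`. -/
noncomputable def rep : Pol q Y →ₐ[ℂ] Module.End ℂ (ℤ × ℤ → ℂ) :=
  RingQuot.liftAlgHom ℂ ⟨FreeAlgebra.lift ℂ (opFun q Y), opFun_rel q Y⟩

theorem rep_gen (g : Gen) : rep q Y (gen q Y g) = opFun q Y g := by
  unfold rep gen Pol.mk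
  erw [RingQuot.liftAlgHom_mkAlgHom_apply]
  rw [FreeAlgebra.lift_ι_apply]

theorem rep_t11_pow (n : ℕ) (g : ℤ × ℤ → ℂ) (m p : ℤ) :
    rep q Y (gen q Y .t11 ^ n) g (m, p) = g (m - n, p) := by
  induction n generalizing g with
  | zero => simp
  | succ n ih =>
    rw [pow_succ, map_mul, Module.End.mul_apply, ih, rep_gen]
    simp only [opFun, LinearMap.pi_apply, LinearMap.proj_apply]
    congr 2; push_cast; ring

theorem rep_t12_pow (n : ℕ) (g : ℤ × ℤ → ℂ) (m p : ℤ) :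
    rep q Y (gen q Y .t12 ^ n) g (m, p) = (q.c ^ (-m)) ^ n * g (m, p - n) := by
  induction n generalizing g with
  | zero => simp
  | succ n ih =>
    rw [pow_succ, map_mul, Module.End.mul_apply, ih, rep_gen]
    simp only [opFun, LinearMap.pi_apply, LinearMap.smul_apply, LinearMap.proj_apply, smul_eq_mul]
    rw [pow_succ, mul_assoc, show p - (n : ℤ) - 1 = p - ((n + 1 : ℕ) : ℤ) by push_cast; ring]

theorem rep_t12s (g : ℤ × ℤ → ℂ) (m p : ℤ) :
    rep q Y (t12s q Y) g (m, p) = q.c ^ (-m) * g (m, p + 1) := by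
  rw [t12s, map_neg, map_smul, rep_gen]
  simp only [opFun, LinearMap.neg_apply, LinearMap.smul_apply, Pi.neg_apply, Pi.smul_apply,
    LinearMap.pi_apply, LinearMap.proj_apply, smul_eq_mul]
  have := q.c_ne_zero
  field_simp

theorem rep_t12s_pow (n : ℕ) (g : ℤ × ℤ → ℂ) (m p : ℤ) :
    rep q Y (t12s q Y ^ n) g (m, p) = (q.c ^ (-m)) ^ n * g (m, p + n) := by
  induction n generalizing g with
  | zero => simp
  | succ n ih =>
    rw [pow_succ, map_mul, Module.End.mul_apply, ih, rep_t12s, pow_succ, mul_assoc,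
      show p + (n : ℤ) + 1 = p + ((n + 1 : ℕ) : ℤ) by push_cast; ring]

theorem rep_t11s (g : ℤ × ℤ → ℂ) (m p : ℤ) :
    rep q Y (t11s q Y) g (m, p) =
      (q.c ^ (-(m + 1)) * q.c ^ (-(m + 1)) - Y.det) * g (m + 1, p) := by
  rw [t11s, map_neg, rep_gen]
  simp only [opFun, LinearMap.neg_apply, LinearMap.smul_apply, Pi.neg_apply,
    LinearMap.pi_apply, LinearMap.proj_apply, smul_eq_mul]
  ring

theorem rep_t11s_pow (n : ℕ) (g : ℤ × ℤ → ℂ) (m p : ℤ) :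
    rep q Y (t11s q Y ^ n) g (m, p) = (∏ s ∈ Finset.range n,
      (q.c ^ (-(m + s + 1)) * q.c ^ (-(m + s + 1)) - Y.det)) * g (m + n, p) := by
  induction n generalizing g with
  | zero => simp
  | succ n ih =>
    rw [pow_succ, map_mul, Module.End.mul_apply, ih, rep_t11s, Finset.prod_range_succ, mul_assoc,
      show m + (n : ℤ) + 1 = m + ((n + 1 : ℕ) : ℤ) by push_cast; ring]

theorem rep_aeval (P : ℂ[X]) (g : ℤ × ℤ → ℂ) (m p : ℤ) :
    rep q Y (aeval (xel q Y) P) g (m, p) = P.eval (q.c ^ (-m) * q.c ^ (-m)) * g (m, p) := by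
  induction P using Polynomial.induction_on generalizing g with
  | C r => simp
  | add f h hf hh => simp [hf, hh, add_mul]
  | monomial n r ih =>
    have h1 := rep_t12_pow q Y 1
    simp only [pow_one, Nat.cast_one] at h1
    rw [pow_succ, ← mul_assoc, map_mul, map_mul, Module.End.mul_apply, ih, aeval_X, xel, map_mul,
      Module.End.mul_apply, h1, rep_t12s, sub_add_cancel]
    simp only [eval_mul, eval_X]
    ring

theorem rep_monomialMap (i1 i2 j2 j1 : ℕ) (P : ℂ[X]) (g : ℤ × ℤ → ℂ) (m p : ℤ) :
    rep q Y (monomialMap q Y i1 i2 j2 j1 P) g (m + i1, p) =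
      ((q.c ^ (-m)) ^ i2 * (q.c ^ (-m)) ^ j2 * ∏ s ∈ Finset.range j1,
        (q.c ^ (-(m + s + 1)) * q.c ^ (-(m + s + 1)) - Y.det)) *
      P.eval (q.c ^ (-m) * q.c ^ (-m)) * g (m + j1, p - i2 + j2) := by
  rw [monomialMap_apply, map_mul, map_mul, map_mul, map_mul]
  simp only [Module.End.mul_apply]
  rw [rep_t11_pow, add_sub_cancel_right, rep_t12_pow, rep_aeval, rep_t12s_pow, rep_t11s_pow]
  ring

theorem QParam.c_pow_ne_one (n : ℕ) (hn : n ≠ 0) : q.c ^ n ≠ 1 := by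
  intro h
  rw [QParam.c, ← Complex.ofReal_pow, Complex.ofReal_eq_one] at h
  exact (pow_lt_one₀ q.pos.le q.lt_one hn).ne h

theorem normalForm_injective : Function.Injective (normalForm q Y) := by
  rw [injective_iff_map_eq_zero]
  intro ψ hψ
  ext1 i
  by_contra hne
  have hroot : ∀ k : ℕ, (ψ i).eval (q.c ^ (2 * (i.j1 + 1 + k))) = 0 := by
    intro k
    set m : ℤ := -((i.j1 + 1 + k : ℕ) : ℤ) with hm
    set g : ℤ × ℤ → ℂ := Pi.single (m + i.j1, 0) 1 with hg
    have h0 : rep q Y (normalForm q Y ψ) g (m + i.i1, i.i2 - i.j2) = 0 := by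
      rw [hψ, map_zero]; rfl
    rw [normalForm, Finsupp.lsum_apply, Finsupp.sum, map_sum, LinearMap.sum_apply,
      Finset.sum_apply, Finset.sum_eq_single i] at h0
    · rw [rep_monomialMap, hg, show ((i.i2 : ℤ) - i.j2 - i.i2 + i.j2) = 0 by ring,
        Pi.single_eq_same, mul_one] at h0
      have hw : q.c ^ (-m) = q.c ^ (i.j1 + 1 + k) := by rw [hm, neg_neg, zpow_natCast]
      rcases mul_eq_zero.1 h0 with h | h
      · exfalso
        rcases mul_eq_zero.1 h with h | h
        · rw [hw] at h
          exact mul_ne_zero (pow_ne_zero _ (pow_ne_zero _ q.c_ne_zero))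
            (pow_ne_zero _ (pow_ne_zero _ q.c_ne_zero)) h
        · obtain ⟨s, hs, h⟩ := Finset.prod_eq_zero_iff.1 h
          have hs := Finset.mem_range.1 hs
          have hw' : q.c ^ (-(m + s + 1)) = q.c ^ (i.j1 + k - s) := by
            rw [← zpow_natCast, hm, Nat.cast_sub (show s ≤ i.j1 + k by omega)]
            congr 1
            push_cast
            ring
          rw [hw', ← pow_add] at h
          cases Y with
          | principal => exact q.c_pow_ne_one _ (by omega) (sub_eq_zero.1 h)
          | cone => exact pow_ne_zero _ q.c_ne_zero ((sub_eq_zero.1 h).trans rfl)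
      · rw [hw, ← pow_add, ← two_mul] at h
        exact h
    · intro b _ hb
      rw [show m + (i.i1 : ℤ) = (m + i.i1 - b.i1) + b.i1 by ring, rep_monomialMap, hg,
        Pi.single_eq_of_ne, mul_zero]
      intro h
      apply hb
      have ha := congrArg Prod.fst h
      have hb := congrArg Prod.snd h
      simp only at ha hb
      have h1 := i.h1; have h2 := i.h2; have h1' := b.h1; have h2' := b.h2
      rw [Nat.mul_eq_zero] at h1 h2 h1' h2'
      ext <;> omega
    · intro h
      rw [Finsupp.notMem_support_iff.1 h]; simp
  refine hne (Polynomial.eq_zero_of_infinite_isRoot _ ?_)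
  refine Set.infinite_of_injective_forall_mem (f := fun k : ℕ => q.c ^ (2 * (i.j1 + 1 + k)))
    ?_ hroot
  intro a b hab
  simp only [QParam.c, ← Complex.ofReal_pow, Complex.ofReal_inj] at hab
  have := (pow_right_injective₀ q.pos q.lt_one.ne) hab
  omega

end Indep

/-- Every `f ∈ Pol(Y)_q` has a unique decomposition
`f = ∑_{i ∈ M''} t₁₁^{i₁} t₁₂^{i₂} ψ_i(x) t₁₂^{*j₂} t₁₁^{*j₁}`; this is the bijection. -/
noncomputable def normalFormEquiv : (MIdx →₀ ℂ[X]) ≃ₗ[ℂ] Pol q Y :=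
  LinearEquiv.ofBijective (normalForm q Y) ⟨normalForm_injective q Y, normalForm_surjective q Y⟩

/-! ### Distributions -/

/-- Labels `m` of the points `q^{-2m}` of the spectrum of `x`: `m ∈ ℤ₊` for `X̃` (the
progression `q^{-2ℤ₊}`), `m ∈ ℤ` for `Ξ̃` (the progression `q^{2ℤ}`). -/
abbrev QSpace.Spec (Y : QSpace) := {m : ℤ // Y = .principal → 0 ≤ m}

/-- The functionals `f ↦ ψ_i(q^{-2m})`, `i ∈ M''`, on `Pol(Y)_q`. -/
noncomputable def coefVal : Pol q Y →ₗ[ℂ] (MIdx × Y.Spec → ℂ) :=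
  LinearMap.pi fun a => Polynomial.leval (q.c ^ (-2 * (a.2 : ℤ))) ∘ₗ Finsupp.lapply a.1 ∘ₗ
    (normalFormEquiv q Y).symm.toLinearMap

variable (Y₁ Y₂ : QSpace)

/-- `Pol(Y₁ × Y₂)_q = Pol(Y₁)_q^{op} ⊗ Pol(Y₂)_q`. -/
abbrev PolProd := (Pol q Y₁)ᵐᵒᵖ ⊗[ℂ] Pol q Y₂

/-- The space `D(Y₁ × Y₂)_q'` of distributions: formal series in the monomials labelled by
`M'' × M''` whose coefficients are arbitrary functions on the product of the two progressions,
with the topology of pointwise convergence of the coefficients. (It is the completion of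
`Pol(Y₁ × Y₂)_q` along the map `toDist` below.) -/
abbrev Dist (Y₁ Y₂ : QSpace) := (MIdx × Y₁.Spec) × (MIdx × Y₂.Spec) → ℂ

/-- The embedding `Pol(Y₁ × Y₂)_q → D(Y₁ × Y₂)_q'` taking the coefficients:
`f₁ ⊗ f₂ ↦ ψ_{i'}(f₁)(q^{-2m'}) ψ_{i''}(f₂)(q^{-2m''})`. -/
noncomputable def toDist : PolProd q Y₁ Y₂ →ₗ[ℂ] Dist Y₁ Y₂ :=
  LinearMap.pi fun ab => LinearMap.mul' ℂ ℂ ∘ₗ TensorProduct.map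
    (LinearMap.proj ab.1 ∘ₗ coefVal q Y₁ ∘ₗ (MulOpposite.opLinearEquiv ℂ).symm.toLinearMap)
    (LinearMap.proj ab.2 ∘ₗ coefVal q Y₂)

variable {Y₁ Y₂}

/-- The left action `g ↦ K g` of `K ∈ Pol(Y₁ × Y₂)_q` on distributions: the extension by
continuity of the left multiplication by `K` in `Pol(Y₁ × Y₂)_q`. -/
noncomputable def leftMul (K : PolProd q Y₁ Y₂) (g : Dist Y₁ Y₂) : Dist Y₁ Y₂ :=
  limUnder (comap (toDist q Y₁ Y₂) (𝓝 g)) fun p => toDist q Y₁ Y₂ (K * p)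

/-- The right action `g ↦ g K` of `K ∈ Pol(Y₁ × Y₂)_q` on distributions: the extension by
continuity of the right multiplication by `K` in `Pol(Y₁ × Y₂)_q`. -/
noncomputable def rightMul (K : PolProd q Y₁ Y₂) (g : Dist Y₁ Y₂) : Dist Y₁ Y₂ :=
  limUnder (comap (toDist q Y₁ Y₂) (𝓝 g)) fun p => toDist q Y₁ Y₂ (p * K)

/-- The finite functions `D(Y₁ × Y₂)_q` among the distributions. -/
def IsFiniteFunction (ψ : Dist Y₁ Y₂) : Prop := (Function.support ψ).Finite

/-- The integral `∫∫ ψ dν₁ dν₂` of a finite function `ψ`, where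
`∫ f dν = (1 - q²) ∑_m ψ_{0000}(q^{-2m}) q^{-2m}`. -/
noncomputable def integral (ψ : Dist Y₁ Y₂) : ℂ :=
  (1 - q.c ^ 2) ^ 2 * ∑ᶠ m : Y₁.Spec × Y₂.Spec,
    ψ ((MIdx.zero, m.1), (MIdx.zero, m.2)) * q.c ^ (-2 * (m.1 : ℤ)) * q.c ^ (-2 * (m.2 : ℤ))

/-- The pairing `∫∫ f ψ dν₁ dν₂` of a distribution `f` with a finite function `ψ`: the
extension by continuity from polynomials `f`, for which `f ψ` is a finite function. -/
noncomputable def pairing (f ψ : Dist Y₁ Y₂) : ℂ :=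
  limUnder (comap (toDist q Y₁ Y₂) (𝓝 f)) fun p => integral q (leftMul q p ψ)

/-- Polynomial vector-functions `f(λ)`, `λ ∈ ℂ ∖ {0}`: for each finite function `ψ` the integral
`∫∫ f(λ) ψ dν₁ dν₂` is given by an element of `ℂ[λ, λ⁻¹]`. -/
def IsPolynomialVF (f : ℂˣ → Dist Y₁ Y₂) : Prop :=
  ∀ ψ : Dist Y₁ Y₂, IsFiniteFunction ψ →
    ∃ P : LaurentPolynomial ℂ, ∀ lam : ℂˣ, pairing q (f lam) ψ = P.smeval lam

/-! ### The kernels -/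

variable (Y₁ Y₂)

/-- `t_{ij} = t_{ij} ⊗ 1`. -/
noncomputable def t (g : Gen) : PolProd q Y₁ Y₂ := MulOpposite.op (gen q Y₁ g) ⊗ₜ[ℂ] 1

/-- `τ_{ij} = 1 ⊗ t_{ij}`. -/
noncomputable def tau (g : Gen) : PolProd q Y₁ Y₂ := 1 ⊗ₜ[ℂ] gen q Y₂ g

/-- `k₁₁ = t₁₁τ₂₂ - q t₁₂τ₂₁`. -/
noncomputable def k11 : PolProd q Y₁ Y₂ :=
  t q Y₁ Y₂ .t11 * tau q Y₁ Y₂ .t22 - q.c • (t q Y₁ Y₂ .t12 * tau q Y₁ Y₂ .t21)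

/-- `-q t₁₂τ₂₁`. -/
noncomputable def lead : PolProd q Y₁ Y₂ := -(q.c • (t q Y₁ Y₂ .t12 * tau q Y₁ Y₂ .t21))

/-- The distribution `1`. -/
noncomputable def one : Dist Y₁ Y₂ := toDist q Y₁ Y₂ 1

variable {Y₁ Y₂}

/-- `g` is a two-sided inverse of `K` in the bimodule of distributions: `K g = 1 = g K`. -/
def IsInverse (K : PolProd q Y₁ Y₂) (g : Dist Y₁ Y₂) : Prop :=
  leftMul q K g = one q Y₁ Y₂ ∧ rightMul q K g = one q Y₁ Y₂

/-- `K⁻¹ g`, for `K` acting bijectively from the left on distributions. -/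
noncomputable def leftDiv (K : PolProd q Y₁ Y₂) (g : Dist Y₁ Y₂) : Dist Y₁ Y₂ :=
  Function.invFun (leftMul q K) g

/-- `g ↦ z g` with `z = q t₁₂⁻¹ t₁₁`. -/
noncomputable def zMul (g : Dist Y₁ Y₂) : Dist Y₁ Y₂ :=
  q.c • leftDiv q (t q Y₁ Y₂ .t12) (leftMul q (t q Y₁ Y₂ .t11) g)

/-- `g ↦ ζ^* g` with `ζ^* = τ₂₁⁻¹ τ₂₂`. -/
noncomputable def zetaStarMul (g : Dist Y₁ Y₂) : Dist Y₁ Y₂ :=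
  leftDiv q (tau q Y₁ Y₂ .t21) (leftMul q (tau q Y₁ Y₂ .t22) g)

variable (Y₁ Y₂) in
/-- The distribution `(z ζ^*)^n`. -/
noncomputable def zZetaPow (n : ℕ) : Dist Y₁ Y₂ :=
  (fun g => zMul q (zetaStarMul q g))^[n] (one q Y₁ Y₂)

/-- `(a; q²)_n = ∏_{j<n} (1 - a q^{2j})`. -/
noncomputable def qPoch (a : ℂ) (n : ℕ) : ℂ := ∏ j ∈ Finset.range n, (1 - a * q.c ^ (2 * j))

/-- The point `λ = q^{2l}`. -/
noncomputable def qPt (l : ℕ) : ℂˣ := Units.mk0 q.c q.c_ne_zero ^ (2 * l)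

end QSU

/-! The algebra `Pol(Y)_q` acts by weighted shifts on functions of two integer labels, and the
normal form is the list of matrix entries of this action. The monomial with index i at the spectral
point m contributes only at row m + i₁, column m + j₁ and displacement i₂ - j₂. This is a bijection
from coefficient labels onto the positions over the spectrum, and the conversion factor never
vanishes (`pos_injective`, `exists_pos_eq`, `mat_pos`, `wt_ne_zero`). A distribution is therefore an
arbitrary pair-indexed matrix, and multiplication by a generator is a continuous weighted shift of
rows or columns. In the first factor the opposite product exchanges the two. Polynomials are dense,
so the actions defined through limits are the evident ones (`limUnder_toDist`).

The elements t₁₂ and τ₂₁ only change displacements and have nonzero weights, hence they act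
bijectively. Right multiplication by k₁₁ has two terms: an invertible one from -q t₁₂τ₂₁, and one
that lowers the row a of the first factor and the column b' of the second. If one factor is X̃, then
a or b' is bounded below and induction gives injectivity (`rightMul_k11_injective`).

The candidate for k₁₁^{-l} is (-q t₁₂τ₂₁)^{-l} f(q^{2l}). Its entries lie on diagonals indexed by n,
and multiplying it by k₁₁ on the right lowers l by one. This reduces to (1 - λq^{2n+2}) - (1 -
q^{2n+2}) = q^{2n+2}(1 - λ), see `kernelEntry_recurrence`. The descent ends at f(1) = 1, because (1;
q²)_n = 0 for n ≥ 1. A right relation g k = 1 gives k g = 1 by associativity and injectivity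
(`isInverse_iff`).

The invariant integral acts as a weighted trace: pairing with a finite function is a finite weighted
sum of transposed entries (`pairing_sum`). Each entry of f(λ) involves a single (λ; q²)_n, so f is
polynomial. Pairings separate distributions, and a Laurent polynomial is determined by its values at
the infinitely many points q^{2l}, so f is unique. -/

namespace QSU

/-! ### Matrix entries and generator shifts in one factor. -/

section OneFactor

variable (q : QParam) (Y : QSpace)

/-- The matrix of an element of `Pol(Y)_q` in the representation `rep`: `(a, b, d)` is the entry
in row `a` and column `b` that raises the second label by `d`. -/
noncomputable def mat (f : Pol q Y) (x : ℤ × ℤ × ℤ) : ℂ :=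
  rep q Y f (Pi.single (x.2.1, 0) 1) (x.1, x.2.2)

/-- The matrix position of the coefficient with label `(i, m)`. -/
def pos (u : MIdx × Y.Spec) : ℤ × ℤ × ℤ :=
  (u.2 + u.1.i1, u.2 + u.1.j1, u.1.i2 - u.1.j2)

/-- The ratio of a matrix entry and the corresponding coefficient. -/
noncomputable def wt (u : MIdx × Y.Spec) : ℂ :=
  (q.c ^ (-(u.2 : ℤ))) ^ u.1.i2 * (q.c ^ (-(u.2 : ℤ))) ^ u.1.j2 * ∏ s ∈ Finset.range u.1.j1,
    (q.c ^ (-((u.2 : ℤ) + s + 1)) * q.c ^ (-((u.2 : ℤ) + s + 1)) - Y.det)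

/-- The matrix positions over the spectrum. -/
def specPos : Set (ℤ × ℤ × ℤ) := {x | Y = .principal → 0 ≤ x.1 ∧ 0 ≤ x.2.1}

theorem pos_mem_specPos (u : MIdx × Y.Spec) : pos Y u ∈ specPos Y := by
  intro h
  have := u.2.2 h
  simp only [pos]
  omega

/-- The conditions i₁j₁ = i₂j₂ = 0 make (i₁, j₁) and (i₂, j₂) the positive and negative parts of a -
b and of d. The spectral label is then min(a, b). -/
theorem exists_pos_eq {x : ℤ × ℤ × ℤ} (hx : x ∈ specPos Y) : ∃ u, pos Y u = x := by
  obtain ⟨a, b, d⟩ := x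
  refine ⟨(⟨(a - b).toNat, d.toNat, (b - a).toNat, (-d).toNat, ?_, ?_⟩, ⟨min a b, ?_⟩), ?_⟩
  · rw [Nat.mul_eq_zero]; omega
  · rw [Nat.mul_eq_zero]; omega
  · intro h
    have := hx h
    simp only at this
    omega
  · simp only [pos, Prod.mk.injEq]
    omega

theorem pos_injective : Function.Injective (pos Y) := by
  rintro ⟨i, m⟩ ⟨j, n⟩ h
  simp only [pos, Prod.mk.injEq] at h
  have h1 := i.h1; have h2 := i.h2; have h1' := j.h1; have h2' := j.h2
  rw [Nat.mul_eq_zero] at h1 h2 h1' h2'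
  refine Prod.ext (MIdx.ext ?_ ?_ ?_ ?_) (Subtype.ext ?_) <;> simp only <;> omega

theorem QParam.c_zpow_ne_one (n : ℤ) (hn : n ≠ 0) : q.c ^ n ≠ 1 := by
  obtain ⟨k, rfl | rfl⟩ := n.eq_nat_or_neg
  · rw [zpow_natCast]; exact q.c_pow_ne_one k (by omega)
  · rw [zpow_neg, zpow_natCast, ne_eq, inv_eq_one]; exact q.c_pow_ne_one k (by omega)

/-- For X̃ the factors are q^{-2(m+s+1)} - 1, and m ≥ 0 keeps the exponent away from 0. For the cone
the factors are pure powers of q. -/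
theorem wt_ne_zero (u : MIdx × Y.Spec) : wt q Y u ≠ 0 := by
  have hq := q.c_ne_zero
  refine mul_ne_zero (mul_ne_zero (pow_ne_zero _ (zpow_ne_zero _ hq))
    (pow_ne_zero _ (zpow_ne_zero _ hq))) (Finset.prod_ne_zero_iff.2 fun s _ => ?_)
  rw [← zpow_add₀ hq]
  have hm := u.2.2
  cases Y with
  | principal =>
    have := hm rfl
    exact sub_ne_zero.2 (q.c_zpow_ne_one _ (by omega))
  | cone => simpa [QSpace.det] using zpow_ne_zero _ hq

theorem coefVal_normalForm (ψ : MIdx →₀ ℂ[X]) (u : MIdx × Y.Spec) :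
    coefVal q Y (normalForm q Y ψ) u = (ψ u.1).eval (q.c ^ (-2 * (u.2 : ℤ))) := by
  have : (normalFormEquiv q Y).symm (normalForm q Y ψ) = ψ :=
    (normalFormEquiv q Y).symm_apply_apply ψ
  simp only [coefVal, LinearMap.pi_apply, LinearMap.comp_apply, LinearEquiv.coe_coe, this,
    Finsupp.lapply_apply, Polynomial.leval_apply]

theorem rep_normalForm (ψ : MIdx →₀ ℂ[X]) (g : ℤ × ℤ → ℂ) (y : ℤ × ℤ) :
    rep q Y (normalForm q Y ψ) g y =
      ∑ i ∈ ψ.support, rep q Y (monomialMap q Y i.i1 i.i2 i.j2 i.j1 (ψ i)) g y := by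
  rw [normalForm, Finsupp.lsum_apply, Finsupp.sum, map_sum, LinearMap.sum_apply, Finset.sum_apply]

theorem rep_monomialMap' (i1 i2 j2 j1 : ℕ) (P : ℂ[X]) (g : ℤ × ℤ → ℂ) (a p : ℤ) :
    rep q Y (monomialMap q Y i1 i2 j2 j1 P) g (a, p) =
      ((q.c ^ (-(a - i1))) ^ i2 * (q.c ^ (-(a - i1))) ^ j2 * ∏ s ∈ Finset.range j1,
        (q.c ^ (-((a - i1) + s + 1)) * q.c ^ (-((a - i1) + s + 1)) - Y.det)) *
      P.eval (q.c ^ (-(a - i1)) * q.c ^ (-(a - i1))) * g (a - i1 + j1, p - i2 + j2) := by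
  rw [← rep_monomialMap, sub_add_cancel]

/-- The representation commutes with translations of the second label. -/
theorem rep_translate (f : Pol q Y) (g : ℤ × ℤ → ℂ) (e a p : ℤ) :
    rep q Y f (fun y => g (y.1, y.2 - e)) (a, p) = rep q Y f g (a, p - e) := by
  obtain ⟨ψ, rfl⟩ := normalForm_surjective q Y f
  rw [rep_normalForm, rep_normalForm]
  refine Finset.sum_congr rfl fun i _ => ?_
  rw [rep_monomialMap', rep_monomialMap']
  congr 3
  ring

theorem rep_single (f : Pol q Y) (b e a p : ℤ) :
    rep q Y f (Pi.single (b, e) 1) (a, p) = mat q Y f (a, b, p - e) := by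
  rw [mat, ← rep_translate]
  refine congrFun (congrArg _ (funext fun y => ?_)) _
  simp only [Pi.single_apply, Prod.ext_iff, sub_eq_zero]

theorem mat_one (x : ℤ × ℤ × ℤ) : mat q Y 1 x = if x.1 = x.2.1 ∧ x.2.2 = 0 then 1 else 0 := by
  simp [mat, Pi.single_apply]

/-- Distinct normal-form indices never meet at the same position, so only one summand survives. -/
theorem mat_pos (f : Pol q Y) (u : MIdx × Y.Spec) :
    mat q Y f (pos Y u) = wt q Y u * coefVal q Y f u := by
  obtain ⟨ψ, rfl⟩ := normalForm_surjective q Y f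
  obtain ⟨i, m⟩ := u
  rw [coefVal_normalForm, mat, rep_normalForm, Finset.sum_eq_single i]
  · simp only [pos, wt]
    rw [rep_monomialMap, show ((i.i2 : ℤ) - i.j2 - i.i2 + i.j2) = 0 by ring, Pi.single_eq_same,
      mul_one, ← zpow_add₀ q.c_ne_zero]
    congr 3
    ring
  · intro b _ hb
    simp only [pos]
    rw [rep_monomialMap', Pi.single_eq_of_ne, mul_zero]
    intro h
    apply hb
    have ha := congrArg Prod.fst h
    have hb := congrArg Prod.snd h
    simp only at ha hb
    have h1 := i.h1; have h2 := i.h2; have h1' := b.h1; have h2' := b.h2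
    rw [Nat.mul_eq_zero] at h1 h2 h1' h2'
    ext <;> omega
  · intro h
    rw [Finsupp.notMem_support_iff.1 h]; simp

/-- The coefficient of the weighted shift of rows given by left multiplication by `t_{ij}`. -/
noncomputable def rowC (g : Gen) (x : ℤ × ℤ × ℤ) : ℂ :=
  match g with
  | .t11 => 1
  | .t12 => q.c ^ (-x.1)
  | .t21 => -(q.c⁻¹ * q.c ^ (-x.1))
  | .t22 => Y.det - q.c ^ (-(x.1 + 1)) * q.c ^ (-(x.1 + 1))

/-- The translation in the weighted shift of rows given by left multiplication by `t_{ij}`. -/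
def rowV : Gen → ℤ × ℤ × ℤ
  | .t11 => (-1, 0, 0)
  | .t12 => (0, 0, -1)
  | .t21 => (0, 0, 1)
  | .t22 => (1, 0, 0)

/-- The coefficient of the weighted shift of columns given by right multiplication by `t_{ij}`. -/
noncomputable def colC (g : Gen) (x : ℤ × ℤ × ℤ) : ℂ :=
  match g with
  | .t11 => 1
  | .t12 => q.c ^ (-x.2.1)
  | .t21 => -(q.c⁻¹ * q.c ^ (-x.2.1))
  | .t22 => Y.det - q.c ^ (-x.2.1) * q.c ^ (-x.2.1)

/-- The translation in the weighted shift of columns given by right multiplication by `t_{ij}`. -/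
def colV : Gen → ℤ × ℤ × ℤ
  | .t11 => (0, 1, 0)
  | .t12 => (0, 0, -1)
  | .t21 => (0, 0, 1)
  | .t22 => (0, -1, 0)

theorem mat_gen_mul (g : Gen) (f : Pol q Y) (x : ℤ × ℤ × ℤ) :
    mat q Y (gen q Y g * f) x = rowC q Y g x * mat q Y f (x + rowV g) := by
  obtain ⟨a, b, d⟩ := x
  simp only [mat, map_mul, Module.End.mul_apply, rep_gen]
  cases g <;> simp [opFun, rowC, rowV, sub_eq_add_neg]

theorem mat_mul_gen (g : Gen) (f : Pol q Y) (x : ℤ × ℤ × ℤ) :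
    mat q Y (f * gen q Y g) x = colC q Y g x * mat q Y f (x + colV g) := by
  obtain ⟨a, b, d⟩ := x
  -- A generator sends a basis vector to a multiple of a basis vector. The second label of the
  -- result is moved back to 0 by `rep_single`.
  have key : opFun q Y g (Pi.single (b, 0) 1) =
      colC q Y g (a, b, d) • Pi.single (b + (colV g).2.1, -(colV g).2.2) 1 := by
    funext ⟨m, p⟩
    cases g <;>
      simp only [opFun, colC, colV, LinearMap.pi_apply, LinearMap.proj_apply, LinearMap.smul_apply,
        Pi.smul_apply, smul_eq_mul, Pi.single_apply, Prod.mk.injEq] <;>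
      split_ifs with h1 h2 h2 <;> first | (exfalso; omega) | simp
    all_goals
      obtain ⟨rfl, -⟩ := h1
      simp only [neg_add_rev, ← zpow_neg, true_or, Int.add_comm]
  rw [mat, map_mul, Module.End.mul_apply, rep_gen, key, map_smul, Pi.smul_apply, rep_single,
    smul_eq_mul]
  congr 2
  cases g <;> simp [colV, sub_eq_add_neg]

/-- The matrix over the spectrum. -/
noncomputable def specMat (f : Pol q Y) : ℤ × ℤ × ℤ → ℂ := (specPos Y).indicator (mat q Y f)

/-- Functions supported on nonnegative first labels form an invariant subspace for X̃: the step of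
t₁₁^* from label 0 to label -1 has weight zero. -/
theorem mat_eq_zero (f : Pol q .principal) {a b : ℤ} (d : ℤ) (ha : a < 0) (hb : 0 ≤ b) :
    mat q .principal f (a, b, d) = 0 := by
  obtain ⟨ψ, rfl⟩ := normalForm_surjective q .principal f
  rw [mat, rep_normalForm]
  refine Finset.sum_eq_zero fun i _ => ?_
  rw [rep_monomialMap']
  by_cases h : a - i.i1 + i.j1 = b
  -- This is the index s at which the exponent a - i₁ + s + 1 vanishes, so the factor is 1 - 1. It
  -- lies in the range because b = a - i₁ + j₁ ≥ 0.
  · rw [Finset.prod_eq_zero (i := (-(a - i.i1) - 1).toNat)]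
    · simp
    · rw [Finset.mem_range]; omega
    · rw [← zpow_add₀ q.c_ne_zero, QSpace.det, sub_eq_zero]
      convert zpow_zero q.c using 2
      have : (((-(a - i.i1) - 1).toNat : ℕ) : ℤ) = -(a - i.i1) - 1 := Int.toNat_of_nonneg (by omega)
      rw [this]
      ring
  · rw [Pi.single_eq_of_ne, mul_zero]
    simp [h]

/-- Cutting the matrix down to the spectrum loses nothing: a row shift leaves the spectrum only
towards a negative row with a nonnegative column, where `mat_eq_zero` applies. -/
theorem specMat_gen_mul (g : Gen) (f : Pol q Y) {x : ℤ × ℤ × ℤ} (hx : x ∈ specPos Y) :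
    specMat q Y (gen q Y g * f) x = rowC q Y g x * specMat q Y f (x + rowV g) := by
  rw [specMat, specMat, Set.indicator_of_mem hx, mat_gen_mul]
  by_cases h : x + rowV g ∈ specPos Y
  · rw [Set.indicator_of_mem h]
  · rw [Set.indicator_of_notMem h, mul_zero]
    obtain ⟨a, b, d⟩ := x
    cases Y with
    | cone => exact absurd (fun h => by cases h) h
    | principal =>
      have hx := hx rfl
      simp only at hx
      have h : a + (rowV g).1 < 0 := by
        by_contra h'
        refine h fun _ => ⟨not_lt.1 h', ?_⟩
        cases g <;> simp [rowV, hx]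
      rw [show ((a, b, d) + rowV g : ℤ × ℤ × ℤ) = (a + (rowV g).1, b, d + (rowV g).2.2) by
        cases g <;> simp [rowV], mat_eq_zero q f _ h hx.2, mul_zero]

/-- Here the only exit from the spectrum is by t₂₂ at column 0, where the weight 1 - q^{-2b} is
itself zero. -/
theorem specMat_mul_gen (g : Gen) (f : Pol q Y) {x : ℤ × ℤ × ℤ} (hx : x ∈ specPos Y) :
    specMat q Y (f * gen q Y g) x = colC q Y g x * specMat q Y f (x + colV g) := by
  rw [specMat, specMat, Set.indicator_of_mem hx, mat_mul_gen]
  by_cases h : x + colV g ∈ specPos Y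
  · rw [Set.indicator_of_mem h]
  · rw [Set.indicator_of_notMem h, mul_zero]
    obtain ⟨a, b, d⟩ := x
    cases Y with
    | cone => exact absurd (fun h => by cases h) h
    | principal =>
      have hx := hx rfl
      simp only at hx
      cases g with
      | t11 => exact absurd (fun _ => by simp [colV]; omega) h
      | t12 => exact absurd (fun _ => by simpa [colV] using hx) h
      | t21 => exact absurd (fun _ => by simpa [colV] using hx) h
      | t22 =>
        have hb : b = 0 := by
          by_contra h'
          refine h fun _ => ?_
          simp [colV]
          omega
        simp [colC, hb, QSpace.det]

end OneFactor

/-! ### Distributions as matrices, multiplications as weighted shifts. -/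

section Entries

variable (q : QParam) {Y₁ Y₂ : QSpace}

/-- Positions of the entries of a distribution on `Y₁ × Y₂`. -/
abbrev Position := (ℤ × ℤ × ℤ) × (ℤ × ℤ × ℤ)

variable (Y₁ Y₂) in
/-- Positions over the spectra. -/
def specPosition : Set Position := specPos Y₁ ×ˢ specPos Y₂

variable (Y₁ Y₂) in
/-- The position of a coefficient. -/
def position (u : (MIdx × Y₁.Spec) × (MIdx × Y₂.Spec)) : Position := (pos Y₁ u.1, pos Y₂ u.2)

theorem position_injective : Function.Injective (position Y₁ Y₂) := fun _ _ h =>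
  Prod.ext (pos_injective Y₁ (congrArg Prod.fst h)) (pos_injective Y₂ (congrArg Prod.snd h))

theorem position_mem (u : (MIdx × Y₁.Spec) × (MIdx × Y₂.Spec)) :
    position Y₁ Y₂ u ∈ specPosition Y₁ Y₂ :=
  ⟨pos_mem_specPos Y₁ u.1, pos_mem_specPos Y₂ u.2⟩

theorem exists_position_eq {x : Position} (hx : x ∈ specPosition Y₁ Y₂) :
    ∃ u, position Y₁ Y₂ u = x := by
  obtain ⟨u, hu⟩ := exists_pos_eq Y₁ hx.1
  obtain ⟨v, hv⟩ := exists_pos_eq Y₂ hx.2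
  exact ⟨(u, v), Prod.ext hu hv⟩

/-- The ratio of a matrix entry and the corresponding coefficient of a distribution. -/
noncomputable def weight (u : (MIdx × Y₁.Spec) × (MIdx × Y₂.Spec)) : ℂ :=
  wt q Y₁ u.1 * wt q Y₂ u.2

theorem weight_ne_zero (u : (MIdx × Y₁.Spec) × (MIdx × Y₂.Spec)) : weight q u ≠ 0 :=
  mul_ne_zero (wt_ne_zero q Y₁ u.1) (wt_ne_zero q Y₂ u.2)

open Classical in
/-- The matrix entries of a distribution; they vanish away from the spectra. -/
noncomputable def entry : Dist Y₁ Y₂ →L[ℂ] (Position → ℂ) :=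
  ContinuousLinearMap.pi fun x => if h : ∃ u, position Y₁ Y₂ u = x then
    weight q h.choose • ContinuousLinearMap.proj h.choose else 0

theorem entry_position (F : Dist Y₁ Y₂) (u) :
    entry q F (position Y₁ Y₂ u) = weight q u * F u := by
  have h : ∃ v, position Y₁ Y₂ v = position Y₁ Y₂ u := ⟨u, rfl⟩
  have hu : h.choose = u := position_injective h.choose_spec
  simp only [entry, ContinuousLinearMap.pi_apply, dif_pos h]
  rw [hu]
  simp

theorem entry_eq_zero (F : Dist Y₁ Y₂) {x : Position} (hx : x ∉ specPosition Y₁ Y₂) :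
    entry q F x = 0 := by
  have h : ¬ ∃ v, position Y₁ Y₂ v = x := by
    rintro ⟨v, rfl⟩
    exact hx (position_mem v)
  simp only [entry, ContinuousLinearMap.pi_apply, dif_neg h]
  simp

/-- The distribution with given matrix entries over the spectra. -/
noncomputable def ofEntry : (Position → ℂ) →L[ℂ] Dist Y₁ Y₂ :=
  ContinuousLinearMap.pi fun u => (weight q u)⁻¹ • ContinuousLinearMap.proj (position Y₁ Y₂ u)

theorem ofEntry_apply (G : Position → ℂ) (u : (MIdx × Y₁.Spec) × (MIdx × Y₂.Spec)) :
    ofEntry q G u = (weight q u)⁻¹ * G (position Y₁ Y₂ u) := rfl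

theorem entry_ofEntry (G : Position → ℂ) {x : Position} (hx : x ∈ specPosition Y₁ Y₂) :
    entry q (ofEntry q G : Dist Y₁ Y₂) x = G x := by
  obtain ⟨u, rfl⟩ := exists_position_eq hx
  rw [entry_position, ofEntry_apply, mul_inv_cancel_left₀ (weight_ne_zero q u)]

theorem entry_ext {F G : Dist Y₁ Y₂}
    (h : ∀ x ∈ specPosition Y₁ Y₂, entry q F x = entry q G x) : F = G := by
  funext u
  have := h _ (position_mem u)
  rw [entry_position, entry_position] at this
  exact mul_left_cancel₀ (weight_ne_zero q u) this

/-- The weighted shift of matrix entries. -/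
noncomputable def wshift (c : Position → ℂ) (v : Position) : Dist Y₁ Y₂ →L[ℂ] Dist Y₁ Y₂ :=
  ofEntry q ∘L (ContinuousLinearMap.pi fun x => c x • ContinuousLinearMap.proj (x + v)) ∘L entry q

theorem entry_wshift (c : Position → ℂ) (v : Position) (F : Dist Y₁ Y₂) {x : Position}
    (hx : x ∈ specPosition Y₁ Y₂) : entry q (wshift q c v F) x = c x * entry q F (x + v) := by
  rw [wshift, ContinuousLinearMap.comp_apply, entry_ofEntry q _ hx]
  rfl

theorem toDist_tmul (f₁ : (Pol q Y₁)ᵐᵒᵖ) (f₂ : Pol q Y₂) (u) :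
    toDist q Y₁ Y₂ (f₁ ⊗ₜ f₂) u = coefVal q Y₁ f₁.unop u.1 * coefVal q Y₂ f₂ u.2 := by
  simp [toDist]

theorem entry_tmul (f₁ : (Pol q Y₁)ᵐᵒᵖ) (f₂ : Pol q Y₂) (x : Position) :
    entry q (toDist q Y₁ Y₂ (f₁ ⊗ₜ f₂)) x =
      specMat q Y₁ f₁.unop x.1 * specMat q Y₂ f₂ x.2 := by
  by_cases hx : x ∈ specPosition Y₁ Y₂
  · obtain ⟨u, rfl⟩ := exists_position_eq hx
    rw [entry_position, toDist_tmul, specMat, specMat, Set.indicator_of_mem hx.1,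
      Set.indicator_of_mem hx.2, position, mat_pos, mat_pos, weight]
    ring
  · rw [entry_eq_zero q _ hx]
    rcases not_and_or.1 hx with h | h
    · rw [specMat, Set.indicator_of_notMem h, zero_mul]
    · rw [specMat, specMat, Set.indicator_of_notMem h, mul_zero]

/-- Left multiplication by `t_{ij} ⊗ 1` as a weighted shift. -/
noncomputable def leftT (g : Gen) : Dist Y₁ Y₂ →L[ℂ] Dist Y₁ Y₂ :=
  wshift q (fun x => colC q Y₁ g x.1) (colV g, 0)

/-- Left multiplication by `1 ⊗ t_{ij}` as a weighted shift. -/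
noncomputable def leftTau (g : Gen) : Dist Y₁ Y₂ →L[ℂ] Dist Y₁ Y₂ :=
  wshift q (fun x => rowC q Y₂ g x.2) (0, rowV g)

/-- Right multiplication by `t_{ij} ⊗ 1` as a weighted shift. -/
noncomputable def rightT (g : Gen) : Dist Y₁ Y₂ →L[ℂ] Dist Y₁ Y₂ :=
  wshift q (fun x => rowC q Y₁ g x.1) (rowV g, 0)

/-- Right multiplication by `1 ⊗ t_{ij}` as a weighted shift. -/
noncomputable def rightTau (g : Gen) : Dist Y₁ Y₂ →L[ℂ] Dist Y₁ Y₂ :=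
  wshift q (fun x => colC q Y₂ g x.2) (0, colV g)

/-- The first tensor factor carries the opposite product, so left multiplication shifts columns
there. -/
theorem leftT_toDist (g : Gen) (p : PolProd q Y₁ Y₂) :
    leftT q g (toDist q Y₁ Y₂ p) = toDist q Y₁ Y₂ (t q Y₁ Y₂ g * p) := by
  induction p using TensorProduct.induction_on with
  | zero => simp
  | add a b ha hb => rw [map_add, map_add, ha, hb, mul_add, map_add]
  | tmul a b =>
    refine entry_ext q fun x hx => ?_
    rw [leftT, entry_wshift q _ _ _ hx, t, Algebra.TensorProduct.tmul_mul_tmul, entry_tmul,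
      entry_tmul, one_mul, MulOpposite.unop_mul, MulOpposite.unop_op, specMat_mul_gen q Y₁ g _ hx.1]
    simp [mul_assoc]

theorem leftTau_toDist (g : Gen) (p : PolProd q Y₁ Y₂) :
    leftTau q g (toDist q Y₁ Y₂ p) = toDist q Y₁ Y₂ (tau q Y₁ Y₂ g * p) := by
  induction p using TensorProduct.induction_on with
  | zero => simp
  | add a b ha hb => rw [map_add, map_add, ha, hb, mul_add, map_add]
  | tmul a b =>
    refine entry_ext q fun x hx => ?_
    rw [leftTau, entry_wshift q _ _ _ hx, tau, Algebra.TensorProduct.tmul_mul_tmul, entry_tmul,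
      entry_tmul, one_mul, specMat_gen_mul q Y₂ g _ hx.2]
    simp [mul_left_comm]

theorem rightT_toDist (g : Gen) (p : PolProd q Y₁ Y₂) :
    rightT q g (toDist q Y₁ Y₂ p) = toDist q Y₁ Y₂ (p * t q Y₁ Y₂ g) := by
  induction p using TensorProduct.induction_on with
  | zero => simp
  | add a b ha hb => rw [map_add, map_add, ha, hb, add_mul, map_add]
  | tmul a b =>
    refine entry_ext q fun x hx => ?_
    rw [rightT, entry_wshift q _ _ _ hx, t, Algebra.TensorProduct.tmul_mul_tmul, entry_tmul,
      entry_tmul, mul_one, MulOpposite.unop_mul, MulOpposite.unop_op, specMat_gen_mul q Y₁ g _ hx.1]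
    simp [mul_assoc]

theorem rightTau_toDist (g : Gen) (p : PolProd q Y₁ Y₂) :
    rightTau q g (toDist q Y₁ Y₂ p) = toDist q Y₁ Y₂ (p * tau q Y₁ Y₂ g) := by
  induction p using TensorProduct.induction_on with
  | zero => simp
  | add a b ha hb => rw [map_add, map_add, ha, hb, add_mul, map_add]
  | tmul a b =>
    refine entry_ext q fun x hx => ?_
    rw [rightTau, entry_wshift q _ _ _ hx, tau, Algebra.TensorProduct.tmul_mul_tmul, entry_tmul,
      entry_tmul, mul_one, specMat_mul_gen q Y₂ g _ hx.2]
    simp [mul_left_comm]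

theorem entry_one {x : Position} (hx : x ∈ specPosition Y₁ Y₂) : entry q (one q Y₁ Y₂) x =
    if x.1.1 = x.1.2.1 ∧ x.1.2.2 = 0 ∧ x.2.1 = x.2.2.1 ∧ x.2.2.2 = 0 then 1 else 0 := by
  rw [one, Algebra.TensorProduct.one_def, entry_tmul, specMat, specMat, Set.indicator_of_mem hx.1,
    Set.indicator_of_mem hx.2, MulOpposite.unop_one, mat_one, mat_one, ite_zero_mul_ite_zero, one_mul]
  simp only [and_assoc]

end Entries

/-! ### Density of polynomials and the bimodule structure by continuity. -/

section Extension

variable (q : QParam) {Y₁ Y₂ : QSpace}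

-- Lagrange interpolation at the points q^{-2m}, which are pairwise distinct, inside a single
-- normal-form component.
open Classical in
theorem exists_monomial (Y : QSpace) (u : MIdx × Y.Spec) (I : Finset (MIdx × Y.Spec)) :
    ∃ f : Pol q Y, ∀ v ∈ I, coefVal q Y f v = if v = u then 1 else 0 := by
  have hinj : Function.Injective fun m : Y.Spec => q.c ^ (-2 * (m : ℤ)) := by
    intro m n h
    by_contra hne
    refine q.c_zpow_ne_one (-2 * (m : ℤ) - -2 * (n : ℤ)) ?_ ?_
    · intro h'
      exact hne (Subtype.ext (by omega))
    · rw [zpow_sub₀ q.c_ne_zero, div_eq_one_iff_eq (zpow_ne_zero _ q.c_ne_zero)]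
      exact h
  let S : Finset Y.Spec := insert u.2 (I.image Prod.snd)
  let P : ℂ[X] := Lagrange.interpolate S (fun m : Y.Spec => q.c ^ (-2 * (m : ℤ)))
    (fun m => if m = u.2 then 1 else 0)
  refine ⟨normalForm q Y (Finsupp.single u.1 P), fun v hv => ?_⟩
  rw [coefVal_normalForm, Finsupp.single_apply]
  by_cases h : u.1 = v.1
  · rw [if_pos h, Lagrange.eval_interpolate_at_node _ hinj.injOn
      (Finset.mem_insert_of_mem (Finset.mem_image_of_mem _ hv))]
    simp [Prod.ext_iff, h]
  · rw [if_neg h, if_neg, eval_zero]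
    rintro rfl
    exact h rfl

theorem exists_toDist_eq (I : Finset ((MIdx × Y₁.Spec) × (MIdx × Y₂.Spec))) (F : Dist Y₁ Y₂) :
    ∃ p, ∀ u ∈ I, toDist q Y₁ Y₂ p u = F u := by
  classical
  have h : ∀ u, ∃ p, ∀ v ∈ I, toDist q Y₁ Y₂ p v = if v = u then 1 else 0 := by
    intro u
    obtain ⟨f, hf⟩ := exists_monomial q Y₁ u.1 (I.image Prod.fst)
    obtain ⟨g, hg⟩ := exists_monomial q Y₂ u.2 (I.image Prod.snd)
    refine ⟨MulOpposite.op f ⊗ₜ g, fun v hv => ?_⟩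
    rw [toDist_tmul, MulOpposite.unop_op, hf _ (Finset.mem_image_of_mem _ hv),
      hg _ (Finset.mem_image_of_mem _ hv), ite_zero_mul_ite_zero, one_mul]
    simp only [Prod.ext_iff]
  choose p hp using h
  refine ⟨∑ u ∈ I, F u • p u, fun v hv => ?_⟩
  rw [map_sum, Finset.sum_apply, Finset.sum_eq_single v]
  · simp [hp v v hv]
  · intro u _ hne
    simp [hp u v hv, hne.symm]
  · exact fun h => absurd hv h

/-- A basic neighbourhood constrains finitely many coefficients, and these can be matched exactly by
a polynomial. -/
theorem denseRange_toDist : DenseRange (toDist q Y₁ Y₂) := by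
  intro F
  rw [mem_closure_iff_nhds]
  intro s hs
  rw [nhds_pi, Filter.mem_pi'] at hs
  obtain ⟨I, t, ht, hs⟩ := hs
  obtain ⟨p, hp⟩ := exists_toDist_eq q I F
  exact ⟨toDist q Y₁ Y₂ p, hs fun u hu => by rw [hp u hu]; exact mem_of_mem_nhds (ht u), p, rfl⟩

/-- A functional of polynomials that extends to a continuous function of distributions has this
function as its extension by continuity. -/
theorem limUnder_toDist {Z : Type*} [TopologicalSpace Z] [T2Space Z] [Nonempty Z]
    {φ : PolProd q Y₁ Y₂ → Z} {Φ : Dist Y₁ Y₂ → Z} (hΦ : Continuous Φ)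
    (h : ∀ p, φ p = Φ (toDist q Y₁ Y₂ p)) (F : Dist Y₁ Y₂) :
    limUnder (comap (toDist q Y₁ Y₂) (𝓝 F)) φ = Φ F := by
  have : (comap (toDist q Y₁ Y₂) (𝓝 F)).NeBot :=
    comap_neBot fun s hs => by
      obtain ⟨_, h, p, rfl⟩ := mem_closure_iff_nhds.1 (denseRange_toDist q F) s hs
      exact ⟨p, h⟩
  refine Tendsto.limUnder_eq ?_
  rw [show φ = Φ ∘ toDist q Y₁ Y₂ from funext h]
  exact (hΦ.tendsto F).comp tendsto_comap

theorem pol_subalgebra_eq_top (Y : QSpace) (S : Subalgebra ℂ (Pol q Y)) (h : ∀ g, gen q Y g ∈ S) :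
    S = ⊤ := by
  rw [eq_top_iff]
  rintro p -
  obtain ⟨a, rfl⟩ := RingQuot.mkAlgHom_surjective ℂ (Rel q Y) p
  change Pol.mk q Y a ∈ S
  induction a using FreeAlgebra.induction with
  | grade0 r => rw [AlgHom.commutes]; exact S.algebraMap_mem r
  | grade1 g => exact h g
  | mul a b ha hb => rw [map_mul]; exact S.mul_mem ha hb
  | add a b ha hb => rw [map_add]; exact S.add_mem ha hb

/-- `Pol(Y₁ × Y₂)_q` is generated by the `t_{ij}` and `τ_{ij}`. -/
theorem subalgebra_eq_top (S : Subalgebra ℂ (PolProd q Y₁ Y₂)) (h₁ : ∀ g, t q Y₁ Y₂ g ∈ S)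
    (h₂ : ∀ g, tau q Y₁ Y₂ g ∈ S) : S = ⊤ := by
  have ht : ∀ f : Pol q Y₁, (MulOpposite.op f ⊗ₜ[ℂ] 1 : PolProd q Y₁ Y₂) ∈ S := by
    intro f
    let T : Subalgebra ℂ (Pol q Y₁) :=
      { carrier := {f | (MulOpposite.op f ⊗ₜ[ℂ] 1 : PolProd q Y₁ Y₂) ∈ S}
        mul_mem' := fun {a b} ha hb => by
          have := S.mul_mem hb ha
          rwa [Algebra.TensorProduct.tmul_mul_tmul, ← MulOpposite.op_mul, one_mul] at this
        add_mem' := fun {a b} ha hb => by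
          have := S.add_mem ha hb
          rwa [← TensorProduct.add_tmul, ← MulOpposite.op_add] at this
        algebraMap_mem' := fun r => S.algebraMap_mem r }
    have : T = ⊤ := pol_subalgebra_eq_top q Y₁ T h₁
    exact (this ▸ Algebra.mem_top : f ∈ T)
  have htau : ∀ f : Pol q Y₂, ((1 : (Pol q Y₁)ᵐᵒᵖ) ⊗ₜ[ℂ] f : PolProd q Y₁ Y₂) ∈ S := by
    intro f
    have : S.comap Algebra.TensorProduct.includeRight = ⊤ := pol_subalgebra_eq_top q Y₂ _ h₂
    exact (this ▸ Algebra.mem_top : f ∈ S.comap Algebra.TensorProduct.includeRight)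
  rw [eq_top_iff]
  rintro p -
  induction p using TensorProduct.induction_on with
  | zero => exact S.zero_mem
  | add a b ha hb => exact S.add_mem ha hb
  | tmul a b =>
    have := S.mul_mem (ht a.unop) (htau b)
    rwa [Algebra.TensorProduct.tmul_mul_tmul, one_mul, mul_one] at this

/-- The elements whose multiplication extends continuously form a subalgebra, and it contains the
generators because these act by weighted shifts. -/
theorem exists_left_extension (K : PolProd q Y₁ Y₂) : ∃ L : Dist Y₁ Y₂ →L[ℂ] Dist Y₁ Y₂,
    ∀ p, toDist q Y₁ Y₂ (K * p) = L (toDist q Y₁ Y₂ p) := by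
  let S : Subalgebra ℂ (PolProd q Y₁ Y₂) :=
    { carrier := {K | ∃ L : Dist Y₁ Y₂ →L[ℂ] Dist Y₁ Y₂,
        ∀ p, toDist q Y₁ Y₂ (K * p) = L (toDist q Y₁ Y₂ p)}
      mul_mem' := by
        rintro a b ⟨L, hL⟩ ⟨M, hM⟩
        exact ⟨L ∘L M, fun p => by rw [mul_assoc, hL, hM]; rfl⟩
      add_mem' := by
        rintro a b ⟨L, hL⟩ ⟨M, hM⟩
        exact ⟨L + M, fun p => by rw [add_mul, map_add, hL, hM]; rfl⟩
      algebraMap_mem' := fun r => ⟨r • ContinuousLinearMap.id ℂ _, fun p => by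
        rw [← Algebra.smul_def, map_smul]; rfl⟩ }
  have : S = ⊤ := subalgebra_eq_top q S (fun g => ⟨leftT q g, fun p => (leftT_toDist q g p).symm⟩)
    (fun g => ⟨leftTau q g, fun p => (leftTau_toDist q g p).symm⟩)
  exact (this ▸ Algebra.mem_top : K ∈ S)

theorem exists_right_extension (K : PolProd q Y₁ Y₂) : ∃ L : Dist Y₁ Y₂ →L[ℂ] Dist Y₁ Y₂,
    ∀ p, toDist q Y₁ Y₂ (p * K) = L (toDist q Y₁ Y₂ p) := by
  let S : Subalgebra ℂ (PolProd q Y₁ Y₂) :=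
    { carrier := {K | ∃ L : Dist Y₁ Y₂ →L[ℂ] Dist Y₁ Y₂,
        ∀ p, toDist q Y₁ Y₂ (p * K) = L (toDist q Y₁ Y₂ p)}
      mul_mem' := by
        rintro a b ⟨L, hL⟩ ⟨M, hM⟩
        exact ⟨M ∘L L, fun p => by rw [← mul_assoc, hM, hL]; rfl⟩
      add_mem' := by
        rintro a b ⟨L, hL⟩ ⟨M, hM⟩
        exact ⟨L + M, fun p => by rw [mul_add, map_add, hL, hM]; rfl⟩
      algebraMap_mem' := fun r => ⟨r • ContinuousLinearMap.id ℂ _, fun p => by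
        rw [← Algebra.commutes, ← Algebra.smul_def, map_smul]; rfl⟩ }
  have : S = ⊤ := subalgebra_eq_top q S (fun g => ⟨rightT q g, fun p => (rightT_toDist q g p).symm⟩)
    (fun g => ⟨rightTau q g, fun p => (rightTau_toDist q g p).symm⟩)
  exact (this ▸ Algebra.mem_top : K ∈ S)

theorem leftMul_eq {K : PolProd q Y₁ Y₂} {L : Dist Y₁ Y₂ → Dist Y₁ Y₂} (hc : Continuous L)
    (hL : ∀ p, toDist q Y₁ Y₂ (K * p) = L (toDist q Y₁ Y₂ p)) : leftMul q K = L :=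
  funext fun F => limUnder_toDist q hc hL F

theorem rightMul_eq {K : PolProd q Y₁ Y₂} {L : Dist Y₁ Y₂ → Dist Y₁ Y₂} (hc : Continuous L)
    (hL : ∀ p, toDist q Y₁ Y₂ (p * K) = L (toDist q Y₁ Y₂ p)) : rightMul q K = L :=
  funext fun F => limUnder_toDist q hc hL F

theorem leftMul_toDist (K p : PolProd q Y₁ Y₂) :
    leftMul q K (toDist q Y₁ Y₂ p) = toDist q Y₁ Y₂ (K * p) := by
  obtain ⟨L, hL⟩ := exists_left_extension q K
  rw [leftMul_eq q L.continuous hL, hL]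

theorem rightMul_toDist (K p : PolProd q Y₁ Y₂) :
    rightMul q K (toDist q Y₁ Y₂ p) = toDist q Y₁ Y₂ (p * K) := by
  obtain ⟨L, hL⟩ := exists_right_extension q K
  rw [rightMul_eq q L.continuous hL, hL]

theorem continuous_leftMul (K : PolProd q Y₁ Y₂) : Continuous (leftMul q K) := by
  obtain ⟨L, hL⟩ := exists_left_extension q K
  rw [leftMul_eq q L.continuous hL]
  exact L.continuous

theorem continuous_rightMul (K : PolProd q Y₁ Y₂) : Continuous (rightMul q K) := by
  obtain ⟨L, hL⟩ := exists_right_extension q K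
  rw [rightMul_eq q L.continuous hL]
  exact L.continuous

theorem leftMul_mul (K K' : PolProd q Y₁ Y₂) :
    leftMul q (K * K') = leftMul q K ∘ leftMul q K' :=
  leftMul_eq q ((continuous_leftMul q K).comp (continuous_leftMul q K')) fun p => by
    rw [Function.comp_apply, leftMul_toDist, leftMul_toDist, mul_assoc]

theorem rightMul_mul (K K' : PolProd q Y₁ Y₂) :
    rightMul q (K * K') = rightMul q K' ∘ rightMul q K :=
  rightMul_eq q ((continuous_rightMul q K').comp (continuous_rightMul q K)) fun p => by
    rw [Function.comp_apply, rightMul_toDist, rightMul_toDist, mul_assoc]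

theorem leftMul_one : leftMul q (1 : PolProd q Y₁ Y₂) = id :=
  leftMul_eq q continuous_id fun p => by rw [one_mul, id]

theorem rightMul_one : rightMul q (1 : PolProd q Y₁ Y₂) = id :=
  rightMul_eq q continuous_id fun p => by rw [mul_one, id]

theorem leftMul_pow (K : PolProd q Y₁ Y₂) (n : ℕ) : leftMul q (K ^ n) = (leftMul q K)^[n] := by
  induction n with
  | zero => rw [pow_zero, leftMul_one]; rfl
  | succ n ih => rw [pow_succ, leftMul_mul, ih, Function.iterate_succ]

theorem rightMul_pow (K : PolProd q Y₁ Y₂) (n : ℕ) : rightMul q (K ^ n) = (rightMul q K)^[n] := by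
  induction n with
  | zero => rw [pow_zero, rightMul_one]; rfl
  | succ n ih => rw [pow_succ', rightMul_mul, ih, Function.iterate_succ]

theorem leftMul_add_right (K : PolProd q Y₁ Y₂) (F G : Dist Y₁ Y₂) :
    leftMul q K (F + G) = leftMul q K F + leftMul q K G := by
  obtain ⟨L, hL⟩ := exists_left_extension q K
  rw [leftMul_eq q L.continuous hL, map_add]

theorem leftMul_smul_right (K : PolProd q Y₁ Y₂) (r : ℂ) (F : Dist Y₁ Y₂) :
    leftMul q K (r • F) = r • leftMul q K F := by
  obtain ⟨L, hL⟩ := exists_left_extension q K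
  rw [leftMul_eq q L.continuous hL, map_smul]

theorem leftMul_add (K K' : PolProd q Y₁ Y₂) :
    leftMul q (K + K') = leftMul q K + leftMul q K' :=
  leftMul_eq q ((continuous_leftMul q K).add (continuous_leftMul q K')) fun p => by
    rw [Pi.add_apply, leftMul_toDist, leftMul_toDist, add_mul, map_add]

theorem leftMul_smul (r : ℂ) (K : PolProd q Y₁ Y₂) :
    leftMul q (r • K) = r • leftMul q K :=
  leftMul_eq q ((continuous_leftMul q K).const_smul r) fun p => by
    rw [Pi.smul_apply, leftMul_toDist, smul_mul_assoc, map_smul]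

theorem rightMul_add (K K' : PolProd q Y₁ Y₂) :
    rightMul q (K + K') = rightMul q K + rightMul q K' :=
  rightMul_eq q ((continuous_rightMul q K).add (continuous_rightMul q K')) fun p => by
    rw [Pi.add_apply, rightMul_toDist, rightMul_toDist, mul_add, map_add]

theorem rightMul_smul (r : ℂ) (K : PolProd q Y₁ Y₂) :
    rightMul q (r • K) = r • rightMul q K :=
  rightMul_eq q ((continuous_rightMul q K).const_smul r) fun p => by
    rw [Pi.smul_apply, rightMul_toDist, mul_smul_comm, map_smul]

/-- Associativity of the bimodule of distributions. -/
theorem leftMul_rightMul (K K' : PolProd q Y₁ Y₂) (F : Dist Y₁ Y₂) :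
    leftMul q K (rightMul q K' F) = rightMul q K' (leftMul q K F) := by
  refine congrFun ((denseRange_toDist q).equalizer
    ((continuous_leftMul q K).comp (continuous_rightMul q K'))
    ((continuous_rightMul q K').comp (continuous_leftMul q K)) (funext fun p => ?_)) F
  simp only [Function.comp_apply, leftMul_toDist, rightMul_toDist, mul_assoc]

theorem leftMul_t (g : Gen) : leftMul q (t q Y₁ Y₂ g) = leftT q g :=
  leftMul_eq q (leftT q g).continuous fun p => (leftT_toDist q g p).symm

theorem leftMul_tau (g : Gen) : leftMul q (tau q Y₁ Y₂ g) = leftTau q g :=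
  leftMul_eq q (leftTau q g).continuous fun p => (leftTau_toDist q g p).symm

theorem rightMul_t (g : Gen) : rightMul q (t q Y₁ Y₂ g) = rightT q g :=
  rightMul_eq q (rightT q g).continuous fun p => (rightT_toDist q g p).symm

theorem rightMul_tau (g : Gen) : rightMul q (tau q Y₁ Y₂ g) = rightTau q g :=
  rightMul_eq q (rightTau q g).continuous fun p => (rightTau_toDist q g p).symm

end Extension

/-! ### Bijectivity of the leading term and inversion of k₁₁. -/

section Kernel

variable (q : QParam) {Y₁ Y₂ : QSpace}

theorem entry_leftMul_t (g : Gen) (F : Dist Y₁ Y₂) {x : Position} (hx : x ∈ specPosition Y₁ Y₂) :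
    entry q (leftMul q (t q Y₁ Y₂ g) F) x = colC q Y₁ g x.1 * entry q F (x + (colV g, 0)) := by
  rw [leftMul_t, leftT, entry_wshift q _ _ _ hx]

theorem entry_leftMul_tau (g : Gen) (F : Dist Y₁ Y₂) {x : Position} (hx : x ∈ specPosition Y₁ Y₂) :
    entry q (leftMul q (tau q Y₁ Y₂ g) F) x = rowC q Y₂ g x.2 * entry q F (x + (0, rowV g)) := by
  rw [leftMul_tau, leftTau, entry_wshift q _ _ _ hx]

theorem entry_rightMul_t (g : Gen) (F : Dist Y₁ Y₂) {x : Position} (hx : x ∈ specPosition Y₁ Y₂) :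
    entry q (rightMul q (t q Y₁ Y₂ g) F) x = rowC q Y₁ g x.1 * entry q F (x + (rowV g, 0)) := by
  rw [rightMul_t, rightT, entry_wshift q _ _ _ hx]

theorem entry_rightMul_tau (g : Gen) (F : Dist Y₁ Y₂) {x : Position}
    (hx : x ∈ specPosition Y₁ Y₂) :
    entry q (rightMul q (tau q Y₁ Y₂ g) F) x = colC q Y₂ g x.2 * entry q F (x + (0, colV g)) := by
  rw [rightMul_tau, rightTau, entry_wshift q _ _ _ hx]

theorem mem_specPosition_iff {a b d a' b' d' : ℤ} :
    ((a, b, d), (a', b', d')) ∈ specPosition Y₁ Y₂ ↔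
      (Y₁ = .principal → 0 ≤ a ∧ 0 ≤ b) ∧ (Y₂ = .principal → 0 ≤ a' ∧ 0 ≤ b') := Iff.rfl

/-- The inverse is the reversed shift with reciprocal weights. Condition `hv` ensures that no entry
is pushed across the boundary of the spectrum. -/
theorem bijective_wshift (c : Position → ℂ) (v : Position) (hc : ∀ x, c x ≠ 0)
    (hv : ∀ x, x + v ∈ specPosition Y₁ Y₂ ↔ x ∈ specPosition Y₁ Y₂) :
    Function.Bijective (wshift q c v : Dist Y₁ Y₂ → Dist Y₁ Y₂) := by
  have hv' : ∀ x, x - v ∈ specPosition Y₁ Y₂ ↔ x ∈ specPosition Y₁ Y₂ := fun x => by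
    rw [← hv, sub_add_cancel]
  refine ⟨fun F G h => entry_ext q fun x hx => ?_,
    fun G => ⟨wshift q (fun x => (c (x - v))⁻¹) (-v) G, entry_ext q fun x hx => ?_⟩⟩
  · have := congrArg (fun H => entry q H (x - v)) h
    simp only [entry_wshift q _ _ _ ((hv' x).2 hx), sub_add_cancel] at this
    exact mul_left_cancel₀ (hc _) this
  · rw [entry_wshift q _ _ _ hx, entry_wshift q _ _ _ ((hv x).2 hx), add_sub_cancel_right,
      add_neg_cancel_right, mul_inv_cancel_left₀ (hc x)]

theorem bijective_t12 : Function.Bijective (leftMul q (t q Y₁ Y₂ .t12)) := by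
  rw [leftMul_t]
  refine bijective_wshift q _ _ (fun x => zpow_ne_zero _ q.c_ne_zero) fun x => ?_
  simp [specPosition, specPos, colV]

theorem bijective_tau21 : Function.Bijective (leftMul q (tau q Y₁ Y₂ .t21)) := by
  rw [leftMul_tau]
  refine bijective_wshift q _ _ (fun x => neg_ne_zero.2 (mul_ne_zero (inv_ne_zero q.c_ne_zero)
    (zpow_ne_zero _ q.c_ne_zero))) fun x => ?_
  simp [specPosition, specPos, rowV]

theorem lead_eq : lead q Y₁ Y₂ = (-q.c) • (t q Y₁ Y₂ .t12 * tau q Y₁ Y₂ .t21) := by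
  exact (neg_smul q.c (t q Y₁ Y₂ .t12 * tau q Y₁ Y₂ .t21)).symm

theorem k11_eq : k11 q Y₁ Y₂ = t q Y₁ Y₂ .t11 * tau q Y₁ Y₂ .t22 + lead q Y₁ Y₂ := by
  rw [k11, lead, sub_eq_add_neg]

theorem leftMul_lead : leftMul q (lead q Y₁ Y₂) =
    wshift q (fun x => q.c ^ (-x.1.2.1) * q.c ^ (-x.2.1)) ((0, 0, -1), (0, 0, 1)) := by
  funext F
  refine entry_ext q fun x hx => ?_
  obtain ⟨⟨a, b, d⟩, a', b', d'⟩ := x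
  rw [entry_wshift q _ _ _ hx, lead_eq, leftMul_smul, leftMul_mul, Pi.smul_apply, map_smul,
    Pi.smul_apply, Function.comp_apply, entry_leftMul_t q _ _ hx, entry_leftMul_tau]
  · simp only [colC, colV, rowC, rowV, Prod.mk_add_mk, add_zero, smul_eq_mul]
    have := q.c_ne_zero
    field_simp
  · simpa [mem_specPosition_iff, colV] using hx

theorem bijective_lead : Function.Bijective (leftMul q (lead q Y₁ Y₂)) := by
  rw [leftMul_lead]
  refine bijective_wshift q _ _ (fun x => mul_ne_zero (zpow_ne_zero _ q.c_ne_zero)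
    (zpow_ne_zero _ q.c_ne_zero)) fun x => ?_
  simp [specPosition, specPos]

theorem bijective_lead_pow (l : ℕ) : Function.Bijective (leftMul q (lead q Y₁ Y₂ ^ l)) := by
  rw [leftMul_pow]
  exact (bijective_lead q).iterate l

theorem entry_leftMul_lead_pow (l : ℕ) (F : Dist Y₁ Y₂) {a b d a' b' d' : ℤ}
    (hx : ((a, b, d), (a', b', d')) ∈ specPosition Y₁ Y₂) :
    entry q (leftMul q (lead q Y₁ Y₂ ^ l) F) ((a, b, d), (a', b', d')) =
      (q.c ^ (-b) * q.c ^ (-a')) ^ l * entry q F ((a, b, d - l), (a', b', d' + l)) := by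
  induction l generalizing F with
  | zero => simp [leftMul_one]
  | succ l ih =>
    rw [pow_succ, leftMul_mul, Function.comp_apply, ih, leftMul_lead,
      entry_wshift q (x := ((a, b, d - l), (a', b', d' + l))) _ _ _ hx, pow_succ]
    simp only [Prod.mk_add_mk, add_zero]
    rw [show d - (l : ℤ) + -1 = d - ((l + 1 : ℕ) : ℤ) by push_cast; ring,
      show d' + (l : ℤ) + 1 = d' + ((l + 1 : ℕ) : ℤ) by push_cast; ring]
    ring

theorem leftMul_leftDiv {K : PolProd q Y₁ Y₂} (hK : Function.Bijective (leftMul q K))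
    (F : Dist Y₁ Y₂) : leftMul q K (leftDiv q K F) = F :=
  Function.rightInverse_invFun hK.2 F

theorem leftDiv_eq_iff {K : PolProd q Y₁ Y₂} (hK : Function.Bijective (leftMul q K))
    (F G : Dist Y₁ Y₂) : G = leftDiv q K F ↔ leftMul q K G = F := by
  rw [← hK.1.eq_iff, leftMul_leftDiv q hK]

theorem entry_rightMul_k11 (F : Dist Y₁ Y₂) {a b d a' b' d' : ℤ}
    (hx : ((a, b, d), (a', b', d')) ∈ specPosition Y₁ Y₂) :
    entry q (rightMul q (k11 q Y₁ Y₂) F) ((a, b, d), (a', b', d')) =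
      (Y₂.det - q.c ^ (-b') * q.c ^ (-b')) * entry q F ((a - 1, b, d), (a', b' - 1, d')) +
      q.c ^ (-a) * q.c ^ (-b') * entry q F ((a, b, d - 1), (a', b', d' + 1)) := by
  rw [k11_eq, lead_eq, rightMul_add, rightMul_smul, rightMul_mul, rightMul_mul, Pi.add_apply,
    map_add, Pi.add_apply, Pi.smul_apply, map_smul, Pi.smul_apply, Function.comp_apply,
    Function.comp_apply, entry_rightMul_tau q _ _ hx, entry_rightMul_tau q _ _ hx,
    entry_rightMul_t q .t12]
  · congr 1
    -- The shift formula for t₁₁ holds only over the spectrum. If the intermediate position is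
    -- outside, so is the final one, and both entries are zero.
    · by_cases h : ((a, b, d), (a', b' - 1, d')) ∈ specPosition Y₁ Y₂
      · simp only [colV, Prod.mk_add_mk, add_zero, ← sub_eq_add_neg]
        rw [entry_rightMul_t q _ _ h]
        simp [colC, rowC, rowV, sub_eq_add_neg]
      · simp only [colV, Prod.mk_add_mk, add_zero, ← sub_eq_add_neg]
        rw [entry_eq_zero q _ h, entry_eq_zero, mul_zero, mul_zero]
        rw [mem_specPosition_iff] at h hx ⊢
        exact fun h' => h ⟨hx.1, h'.2⟩
    · simp only [colC, colV, rowC, rowV, Prod.mk_add_mk, add_zero, smul_eq_mul,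
        ← sub_eq_add_neg]
      have := q.c_ne_zero
      field_simp
  · simpa [mem_specPosition_iff, colV] using hx

/-- The t₁₁τ₂₂ term involves the entry with a and b' lowered by one, and the other term has nonzero
weight. The equation thus determines each entry from one at a lower level. Left multiplication would
instead raise b and a', which the spectrum does not bound. -/
theorem rightMul_k11_injective (hY : Y₁ = .principal ∨ Y₂ = .principal) :
    Function.Injective (rightMul q (k11 q Y₁ Y₂)) := by
  -- The level η is a when the first factor is X̃ and b' when the second is. For two cones neither
  -- label is bounded below.
  obtain ⟨η, h0, h1⟩ : ∃ η : Position → ℤ, (∀ x ∈ specPosition Y₁ Y₂, 0 ≤ η x) ∧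
      ∀ a b d a' b' d', η ((a - 1, b, d + 1), (a', b' - 1, d' - 1)) =
        η ((a, b, d), (a', b', d')) - 1 := by
    rcases hY with h | h
    · exact ⟨fun x => x.1.1, fun x hx => (hx.1 h).1, fun _ _ _ _ _ _ => rfl⟩
    · exact ⟨fun x => x.2.2.1, fun x hx => (hx.2 h).2, fun _ _ _ _ _ _ => rfl⟩
  intro F G hFG
  have key : ∀ n : ℕ, ∀ x : Position, η x < n → entry q F x = entry q G x := by
    intro n
    induction n with
    | zero =>
      intro x hn
      have hx : x ∉ specPosition Y₁ Y₂ := fun hx => absurd (h0 x hx) (by simpa using hn)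
      rw [entry_eq_zero q _ hx, entry_eq_zero q _ hx]
    | succ n ih =>
      rintro ⟨⟨a, b, d⟩, a', b', d'⟩ hn
      by_cases hx : ((a, b, d), (a', b', d')) ∈ specPosition Y₁ Y₂
      -- Evaluating at displacements d + 1 and d' - 1 makes the invertible term the entry at the
      -- given position.
      · have hx' : ((a, b, d + 1), (a', b', d' - 1)) ∈ specPosition Y₁ Y₂ := hx
        have h := congrArg (fun H => entry q H ((a, b, d + 1), (a', b', d' - 1))) hFG
        simp only [entry_rightMul_k11 q _ hx', add_sub_cancel_right, sub_add_cancel] at h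
        rw [ih ((a - 1, b, d + 1), (a', b' - 1, d' - 1)) (by rw [h1]; push_cast at hn; linarith),
          add_right_inj] at h
        exact mul_left_cancel₀ (mul_ne_zero (zpow_ne_zero _ q.c_ne_zero)
          (zpow_ne_zero _ q.c_ne_zero)) h
      · rw [entry_eq_zero q _ hx, entry_eq_zero q _ hx]
  exact entry_ext q fun x hx => key ((η x).toNat + 1) x (by have := h0 x hx; push_cast; omega)

/-! ### The explicit inverse powers -/

/-- The positions at which `(-q t₁₂ τ₂₁)^{-l} (z ζ^*)^n` has nonzero entries. -/
def diag (l n : ℕ) (b a' : ℤ) : Position := ((b + n, b, -n - l), (a', a' + n, n + l))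

theorem eq_diag_iff {l n : ℕ} {b₁ a₁ a b d a' b' d' : ℤ} :
    ((a, b, d), (a', b', d')) = diag l n b₁ a₁ ↔ a = b₁ + n ∧ b = b₁ ∧ d = -n - l ∧
      a' = a₁ ∧ b' = a₁ + n ∧ d' = n + l := by
  simp only [diag, Prod.mk.injEq, and_assoc]

/-- The factor of the entries of `(z ζ^*)^n`. -/
noncomputable def zProd (Y₂ : QSpace) (n : ℕ) (b a' : ℤ) : ℂ := ∏ s ∈ Finset.range n,
  (q.c ^ 2 * q.c ^ (b + s) * q.c ^ (a' + s) *
    (q.c ^ (-(a' + s + 1)) * q.c ^ (-(a' + s + 1)) - Y₂.det))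

open Classical in
/-- The entries of `(-q t₁₂ τ₂₁)^{-l} f(λ)`. -/
noncomputable def kernelEntry (Y₂ : QSpace) (l : ℕ) (lam : ℂ) (x : Position) : ℂ :=
  -- If a < b the truncated difference is 0, and the equation then fails because it would force a =
  -- b.
  if x = diag l (x.1.1 - x.1.2.1).toNat x.1.2.1 x.2.1 then
    (q.c ^ x.1.2.1 * q.c ^ x.2.1) ^ l * (qPoch q lam (x.1.1 - x.1.2.1).toNat /
      qPoch q (q.c ^ 2) (x.1.1 - x.1.2.1).toNat * zProd q Y₂ (x.1.1 - x.1.2.1).toNat x.1.2.1 x.2.1)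
  else 0

theorem kernelEntry_diag (l n : ℕ) (lam : ℂ) (b a' : ℤ) :
    kernelEntry q Y₂ l lam (diag l n b a') = (q.c ^ b * q.c ^ a') ^ l *
      (qPoch q lam n / qPoch q (q.c ^ 2) n * zProd q Y₂ n b a') := by
  simp [kernelEntry, diag]

theorem kernelEntry_of_ne (l : ℕ) (lam : ℂ) {x : Position} (h : ∀ n b a', x ≠ diag l n b a') :
    kernelEntry q Y₂ l lam x = 0 := by
  rw [kernelEntry, if_neg (h _ _ _)]

variable (Y₁ Y₂) in
/-- The distribution `(-q t₁₂ τ₂₁)^{-l} f(λ)`. -/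
noncomputable def kernelDist (l : ℕ) (lam : ℂ) : Dist Y₁ Y₂ := ofEntry q (kernelEntry q Y₂ l lam)

/-- On a diagonal a ≥ b and b' ≥ a', so bounds on b and a' suffice. This covers the positions with a
= -1 or b' = -1 that right multiplication by k₁₁ reaches. -/
theorem entry_kernelDist (l : ℕ) (lam : ℂ) {a b d a' b' d' : ℤ} (hb : Y₁ = .principal → 0 ≤ b)
    (ha' : Y₂ = .principal → 0 ≤ a') :
    entry q (kernelDist q Y₁ Y₂ l lam) ((a, b, d), (a', b', d')) =
      kernelEntry q Y₂ l lam ((a, b, d), (a', b', d')) := by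
  by_cases hx : ((a, b, d), (a', b', d')) ∈ specPosition Y₁ Y₂
  · exact entry_ofEntry q _ hx
  · rw [entry_eq_zero q _ hx, kernelEntry_of_ne]
    intro n b₁ a₁ h
    simp only [eq_diag_iff] at h
    refine hx ⟨fun h' => ?_, fun h' => ?_⟩
    · have := hb h'; simp only; omega
    · have := ha' h'; simp only; omega

theorem qPoch_ne_zero (n : ℕ) : qPoch q (q.c ^ 2) n ≠ 0 := by
  refine Finset.prod_ne_zero_iff.2 fun j _ => ?_
  rw [← pow_add, sub_ne_zero]
  exact (q.c_pow_ne_one _ (by omega)).symm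

theorem qPoch_succ (lam : ℂ) (n : ℕ) :
    qPoch q lam (n + 1) = qPoch q lam n * (1 - lam * q.c ^ (2 * n)) := Finset.prod_range_succ _ _

theorem qPoch_succ' (lam : ℂ) (n : ℕ) :
    qPoch q lam (n + 1) = (1 - lam) * qPoch q (lam * q.c ^ 2) n := by
  rw [qPoch, Finset.prod_range_succ', mul_comm]
  simp only [mul_zero, pow_zero, mul_one, qPoch]
  congr 1
  refine Finset.prod_congr rfl fun j _ => ?_
  ring

theorem zProd_succ (n : ℕ) (b a' : ℤ) : zProd q Y₂ (n + 1) b a' = zProd q Y₂ n b a' *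
    (q.c ^ 2 * q.c ^ (b + n) * q.c ^ (a' + n) *
      (q.c ^ (-(a' + n + 1)) * q.c ^ (-(a' + n + 1)) - Y₂.det)) := Finset.prod_range_succ _ _

theorem zProd_succ' (n : ℕ) (b a' : ℤ) : zProd q Y₂ (n + 1) b a' =
    q.c ^ 2 * q.c ^ b * q.c ^ a' * (q.c ^ (-(a' + 1)) * q.c ^ (-(a' + 1)) - Y₂.det) *
      zProd q Y₂ n (b + 1) (a' + 1) := by
  rw [zProd, Finset.prod_range_succ', mul_comm]
  simp only [Nat.cast_zero, add_zero, zProd]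
  congr 1
  refine Finset.prod_congr rfl fun j _ => ?_
  push_cast
  simp only [add_assoc, add_comm (1 : ℤ)]

/-- With λ = q^{2l}, all three terms contain (λq²; q²)_n, since (λ; q²)_{n+1} = (1 - λ)(λq²; q²)_n.
What remains is (1 - λq^{2n+2}) - (1 - q^{2n+2}) = q^{2n+2}(1 - λ). -/
theorem kernelEntry_recurrence (l n : ℕ) (b a' : ℤ) :
    (Y₂.det - q.c ^ (-(a' + n + 1)) * q.c ^ (-(a' + n + 1))) *
      kernelEntry q Y₂ (l + 1) (q.c ^ (2 * (l + 1))) (diag (l + 1) n b a') +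
    q.c ^ (-(b + n + 1)) * q.c ^ (-(a' + n + 1)) *
      kernelEntry q Y₂ (l + 1) (q.c ^ (2 * (l + 1))) (diag (l + 1) (n + 1) b a') =
    kernelEntry q Y₂ l (q.c ^ (2 * l)) (diag l (n + 1) b a') := by
  have hq := q.c_ne_zero
  rw [kernelEntry_diag, kernelEntry_diag, kernelEntry_diag, qPoch_succ' q (q.c ^ (2 * l)),
    ← pow_add, show 2 * l + 2 = 2 * (l + 1) by ring, qPoch_succ, qPoch_succ, zProd_succ,
    show q.c ^ (-(b + n + 1)) = (q.c ^ (b + n))⁻¹ * q.c⁻¹ by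
      rw [zpow_neg, zpow_add_one₀ hq, mul_inv],
    ← neg_sub (q.c ^ (-(a' + n + 1)) * q.c ^ (-(a' + n + 1)))]
  -- This factor is the last one of `zProd` at n + 1 and, up to sign, the weight of the first term.
  -- It cancels, so the identity does not depend on the determinant.
  generalize q.c ^ (-(a' + n + 1)) * q.c ^ (-(a' + n + 1)) - Y₂.det = T
  rw [show q.c ^ (-(a' + n + 1)) = (q.c ^ (a' + n))⁻¹ * q.c⁻¹ by
      rw [zpow_neg, zpow_add_one₀ hq, mul_inv],
    show q.c ^ (a' + n) = q.c ^ a' * q.c ^ n by rw [zpow_add₀ hq, zpow_natCast],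
    show q.c ^ (b + n) = q.c ^ b * q.c ^ n by rw [zpow_add₀ hq, zpow_natCast]]
  have hr := qPoch_ne_zero q n
  have hr' : 1 - q.c ^ 2 * q.c ^ (2 * n) ≠ 0 := by
    rw [← pow_add, sub_ne_zero]
    exact (q.c_pow_ne_one _ (by omega)).symm
  have hB : q.c ^ b ≠ 0 := zpow_ne_zero _ hq
  have hA : q.c ^ a' ≠ 0 := zpow_ne_zero _ hq
  generalize qPoch q (q.c ^ 2) n = r at *
  generalize qPoch q (q.c ^ (2 * (l + 1))) n = p at *
  generalize zProd q Y₂ n b a' = W at *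
  generalize q.c ^ b = B at *
  generalize q.c ^ a' = A at *
  rw [show q.c ^ (2 * (l + 1)) = q.c ^ (2 * l) * q.c ^ 2 by ring,
    show q.c ^ (2 * n) = (q.c ^ n) ^ 2 by ring] at *
  have hN : q.c ^ n ≠ 0 := pow_ne_zero _ hq
  generalize q.c ^ n = N at *
  generalize q.c ^ (2 * l) = L at *
  generalize q.c = Q at *
  rw [pow_succ (B * A)]
  generalize (B * A) ^ l = R at *
  rw [mul_comm (Q ^ 2)] at hr'
  field_simp
  ring

theorem rightMul_k11_kernelDist (l : ℕ) :
    rightMul q (k11 q Y₁ Y₂) (kernelDist q Y₁ Y₂ (l + 1) (q.c ^ (2 * (l + 1)))) =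
      kernelDist q Y₁ Y₂ l (q.c ^ (2 * l)) := by
  refine entry_ext q fun x hx => ?_
  obtain ⟨⟨a, b, d⟩, a', b', d'⟩ := x
  have hb : Y₁ = .principal → 0 ≤ b := fun h => (hx.1 h).2
  have ha' : Y₂ = .principal → 0 ≤ a' := fun h => (hx.2 h).1
  rw [entry_rightMul_k11 q _ hx, entry_kernelDist q _ _ hb ha', entry_kernelDist q _ _ hb ha',
    entry_kernelDist q _ _ hb ha']
  by_cases h : ∃ n, ((a, b, d), (a', b', d')) = diag l n b a'
  · obtain ⟨n, h⟩ := h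
    simp only [eq_diag_iff, true_and] at h
    obtain ⟨rfl, rfl, rfl, rfl⟩ := h
    have e : ((b + n, b, -(n : ℤ) - l - 1), (a', a' + n, (n : ℤ) + l + 1)) =
        diag (l + 1) n b a' := by
      simp only [eq_diag_iff, true_and]; push_cast; omega
    have e' : ((b + n, b, -(n : ℤ) - l), (a', a' + n, (n : ℤ) + l)) = diag l n b a' := rfl
    rw [e, e']
    -- For n = 0 the first term sits at row b - 1 and column b, off every diagonal, so only the
    -- invertible term contributes.
    cases n with
    | zero =>
      rw [kernelEntry_of_ne, kernelEntry_diag, kernelEntry_diag]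
      · have hq := q.c_ne_zero
        have hB : q.c ^ b ≠ 0 := zpow_ne_zero _ hq
        have hA : q.c ^ a' ≠ 0 := zpow_ne_zero _ hq
        simp only [qPoch, zProd, Finset.range_zero, Finset.prod_empty, Nat.cast_zero, add_zero,
          zpow_neg]
        rw [pow_succ]
        field_simp
        ring
      · intro n b₁ a₁ h
        rw [eq_diag_iff] at h
        omega
    | succ n =>
      rw [← kernelEntry_recurrence q l n b a']
      have e'' : ((b + ((n + 1 : ℕ) : ℤ) - 1, b, -((n + 1 : ℕ) : ℤ) - l),
          (a', a' + ((n + 1 : ℕ) : ℤ) - 1, ((n + 1 : ℕ) : ℤ) + l)) = diag (l + 1) n b a' := by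
        simp only [eq_diag_iff, true_and]; push_cast; omega
      rw [e'']
      push_cast
      simp only [add_assoc]
  · rw [kernelEntry_of_ne, kernelEntry_of_ne, kernelEntry_of_ne]
    · simp
    · rintro n b₁ a₁ h'
      refine h ⟨n, ?_⟩
      simp only [eq_diag_iff, true_and] at h' ⊢
      omega
    · rintro n b₁ a₁ h'
      refine h ⟨n, ?_⟩
      simp only [eq_diag_iff, true_and] at h' ⊢
      push_cast at h'
      omega
    · rintro n b₁ a₁ h'
      refine h ⟨n + 1, ?_⟩
      simp only [eq_diag_iff, true_and] at h' ⊢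
      push_cast at h' ⊢
      omega

/-- The factor 1 - λ of (λ; q²)_n vanishes at λ = 1 for every n ≥ 1, which leaves only the main
diagonal. -/
theorem kernelDist_zero_one : kernelDist q Y₁ Y₂ 0 1 = one q Y₁ Y₂ := by
  refine entry_ext q fun x hx => ?_
  rw [kernelDist, entry_ofEntry q _ hx, entry_one q hx]
  obtain ⟨⟨a, b, d⟩, a', b', d'⟩ := x
  by_cases h : ∃ n, ((a, b, d), (a', b', d')) = diag 0 n b a'
  · obtain ⟨n, h⟩ := h
    rw [h, kernelEntry_diag]
    cases n with
    | zero => simp [diag, qPoch, zProd]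
    | succ n =>
      rw [qPoch_succ', if_neg]
      · simp
      · simp only [diag]; push_cast; omega
  · rw [kernelEntry_of_ne, if_neg]
    · rintro ⟨h1, h2, h3, h4⟩
      refine h ⟨0, ?_⟩
      simp only at h1 h2 h3 h4
      simp [diag, h1, h2, h3, h4]
    · rintro n b₁ a₁ h'
      refine h ⟨n, ?_⟩
      simp only [eq_diag_iff, true_and] at h' ⊢
      omega

theorem rightMul_k11_pow_kernelDist (l : ℕ) :
    rightMul q (k11 q Y₁ Y₂ ^ l) (kernelDist q Y₁ Y₂ l (q.c ^ (2 * l))) = one q Y₁ Y₂ := by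
  rw [rightMul_pow]
  induction l with
  | zero => simpa using kernelDist_zero_one q
  | succ l ih => rw [Function.iterate_succ_apply, rightMul_k11_kernelDist, ih]

/-- The relation g K = 1 alone fixes g. It also yields K g = 1, since (K g) K = K (g K) = K = 1 K
and K can be cancelled on the right. -/
theorem isInverse_iff (hY : Y₁ = .principal ∨ Y₂ = .principal) (l : ℕ) (g : Dist Y₁ Y₂) :
    IsInverse q (k11 q Y₁ Y₂ ^ l) g ↔ g = kernelDist q Y₁ Y₂ l (q.c ^ (2 * l)) := by
  have hinj : Function.Injective (rightMul q (k11 q Y₁ Y₂ ^ l)) := by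
    rw [rightMul_pow]
    exact (rightMul_k11_injective q hY).iterate l
  have h := rightMul_k11_pow_kernelDist q (Y₁ := Y₁) (Y₂ := Y₂) l
  refine ⟨fun hg => hinj (hg.2.trans h.symm), ?_⟩
  rintro rfl
  refine ⟨hinj ?_, h⟩
  rw [← leftMul_rightMul, h, one, leftMul_toDist, rightMul_toDist, mul_one, one_mul]

theorem leftMul_lead_pow_kernelDist (l : ℕ) (lam : ℂ) :
    leftMul q (lead q Y₁ Y₂ ^ l) (kernelDist q Y₁ Y₂ l lam) = kernelDist q Y₁ Y₂ 0 lam := by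
  refine entry_ext q fun x hx => ?_
  obtain ⟨⟨a, b, d⟩, a', b', d'⟩ := x
  have hb : Y₁ = .principal → 0 ≤ b := fun h => (hx.1 h).2
  have ha' : Y₂ = .principal → 0 ≤ a' := fun h => (hx.2 h).1
  rw [entry_leftMul_lead_pow q l _ hx, entry_kernelDist q _ _ hb ha',
    entry_kernelDist q _ _ hb ha']
  by_cases h : ∃ n, ((a, b, d), (a', b', d')) = diag 0 n b a'
  · obtain ⟨n, h⟩ := h
    have e : ((a, b, d - l), (a', b', d' + l)) = diag l n b a' := by
      simp only [eq_diag_iff, true_and] at h ⊢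
      push_cast at h
      omega
    rw [h, e, kernelEntry_diag, kernelEntry_diag, pow_zero, one_mul, ← mul_assoc, ← mul_pow]
    have hB : q.c ^ b ≠ 0 := zpow_ne_zero _ q.c_ne_zero
    have hA : q.c ^ a' ≠ 0 := zpow_ne_zero _ q.c_ne_zero
    rw [zpow_neg, zpow_neg, ← mul_inv, inv_mul_cancel₀ (mul_ne_zero hB hA), one_pow, one_mul]
  · rw [kernelEntry_of_ne, kernelEntry_of_ne, mul_zero]
    all_goals
      rintro n b₁ a₁ h'
      refine h ⟨n, ?_⟩
      simp only [eq_diag_iff, true_and] at h' ⊢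
      push_cast at h' ⊢
      omega

/-! ### The series -/

theorem entry_zMul (F : Dist Y₁ Y₂) {a b d a' b' d' : ℤ}
    (hx : ((a, b, d), (a', b', d')) ∈ specPosition Y₁ Y₂) :
    entry q (zMul q F) ((a, b, d), (a', b', d')) =
      q.c * q.c ^ b * entry q F ((a, b + 1, d + 1), (a', b', d')) := by
  -- Left multiplication by t₁₂ reads the entry at displacement one lower, so its inverse at d is
  -- found by evaluating at d + 1.
  have hx' : ((a, b, d + 1), (a', b', d')) ∈ specPosition Y₁ Y₂ := hx
  have h := congrArg (fun H => entry q H ((a, b, d + 1), (a', b', d')))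
    (leftMul_leftDiv q (bijective_t12 q) (leftMul q (t q Y₁ Y₂ .t11) F))
  simp only [entry_leftMul_t q _ _ hx', colC, colV, Prod.mk_add_mk, add_zero, one_mul,
    add_neg_cancel_right, zpow_neg] at h
  rw [zMul, map_smul, Pi.smul_apply, smul_eq_mul, mul_assoc,
    ← (inv_mul_eq_iff_eq_mul₀ (zpow_ne_zero b q.c_ne_zero)).1 h]

theorem entry_zetaStarMul (F : Dist Y₁ Y₂) {a b d a' b' d' : ℤ}
    (hx : ((a, b, d), (a', b', d')) ∈ specPosition Y₁ Y₂) :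
    entry q (zetaStarMul q F) ((a, b, d), (a', b', d')) =
      q.c * q.c ^ a' * (q.c ^ (-(a' + 1)) * q.c ^ (-(a' + 1)) - Y₂.det) *
        entry q F ((a, b, d), (a' + 1, b', d' - 1)) := by
  have hx' : ((a, b, d), (a', b', d' - 1)) ∈ specPosition Y₁ Y₂ := hx
  have h := congrArg (fun H => entry q H ((a, b, d), (a', b', d' - 1)))
    (leftMul_leftDiv q (bijective_tau21 q) (leftMul q (tau q Y₁ Y₂ .t22) F))
  simp only [entry_leftMul_tau q _ _ hx', rowC, rowV, Prod.mk_add_mk, add_zero,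
    sub_add_cancel] at h
  have hq := q.c_ne_zero
  have hA : q.c ^ a' ≠ 0 := zpow_ne_zero _ hq
  rw [zpow_neg q.c a', ← mul_inv, neg_mul, neg_eq_iff_eq_neg,
    inv_mul_eq_iff_eq_mul₀ (mul_ne_zero hq hA)] at h
  rw [zetaStarMul, h]
  ring

open Classical in
/-- The entries of `(z ζ^*)^n`. -/
noncomputable def zEntry (Y₂ : QSpace) (n : ℕ) (x : Position) : ℂ :=
  if x = diag 0 n x.1.2.1 x.2.1 then zProd q Y₂ n x.1.2.1 x.2.1 else 0

theorem zZetaPow_eq (n : ℕ) : zZetaPow q Y₁ Y₂ n = ofEntry q (zEntry q Y₂ n) := by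
  refine entry_ext q fun x hx => ?_
  rw [entry_ofEntry q _ hx]
  induction n generalizing x with
  | zero =>
    rw [zZetaPow, Function.iterate_zero, id, entry_one q hx, zEntry]
    obtain ⟨⟨a, b, d⟩, a', b', d'⟩ := x
    simp only [eq_diag_iff, true_and, zProd, Finset.range_zero, Finset.prod_empty]
    refine if_congr ?_ rfl rfl
    push_cast
    omega
  | succ n ih =>
    obtain ⟨⟨a, b, d⟩, a', b', d'⟩ := x
    rw [zZetaPow, Function.iterate_succ_apply', ← zZetaPow, entry_zMul q _ hx, zEntry]
    by_cases h : ((a, b, d), (a', b', d')) = diag 0 (n + 1) b a'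
    · rw [if_pos h, zProd_succ']
      simp only [eq_diag_iff, true_and] at h
      push_cast at h
      have hx₁ : ((a, b + 1, d + 1), (a', b', d')) ∈ specPosition Y₁ Y₂ :=
        ⟨fun h' => by have := hx.1 h'; simp only at this ⊢; omega, hx.2⟩
      have hx₂ : ((a, b + 1, d + 1), (a' + 1, b', d' - 1)) ∈ specPosition Y₁ Y₂ :=
        ⟨hx₁.1, fun h' => by have := hx.2 h'; simp only at this ⊢; omega⟩
      rw [entry_zetaStarMul q _ hx₁, ih _ hx₂, zEntry, if_pos]
      · simp only
        ring
      · simp only [eq_diag_iff, true_and]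
        push_cast
        omega
    · rw [if_neg h]
      by_cases hx₁ : ((a, b + 1, d + 1), (a', b', d')) ∈ specPosition Y₁ Y₂
      · rw [entry_zetaStarMul q _ hx₁]
        by_cases hx₂ : ((a, b + 1, d + 1), (a' + 1, b', d' - 1)) ∈ specPosition Y₁ Y₂
        · rw [ih _ hx₂, zEntry, if_neg, mul_zero, mul_zero]
          intro h'
          apply h
          simp only [eq_diag_iff, true_and] at h' ⊢
          push_cast at h' ⊢
          omega
        · rw [entry_eq_zero q _ hx₂, mul_zero, mul_zero]
      · rw [entry_eq_zero q _ hx₁, mul_zero]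

/-- The powers (zζ^*)^n have disjoint supports, as n = a - b there. Each coefficient receives at
most one term, so convergence holds for every λ. -/
theorem hasSum_kernelDist (lam : ℂ) :
    HasSum (fun n : ℕ => (qPoch q lam n / qPoch q (q.c ^ 2) n) • zZetaPow q Y₁ Y₂ n)
      (kernelDist q Y₁ Y₂ 0 lam) := by
  simp only [zZetaPow_eq, ← map_smul]
  refine (ofEntry q).hasSum (Pi.hasSum.2 fun x => ?_)
  by_cases h : ∃ n, x = diag 0 n x.1.2.1 x.2.1
  · obtain ⟨n, h⟩ := h
    have e : kernelEntry q Y₂ 0 lam x = ((qPoch q lam n / qPoch q (q.c ^ 2) n) •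
        zEntry q Y₂ n) x := by
      rw [Pi.smul_apply, zEntry, if_pos h]
      conv_lhs => rw [h, kernelEntry_diag, pow_zero, one_mul]
      rfl
    rw [e]
    refine hasSum_single n fun m hm => ?_
    rw [Pi.smul_apply, zEntry, if_neg, smul_zero]
    intro h'
    have := congrArg (fun y : Position => y.1.1) (h.symm.trans h')
    simp only [diag] at this
    omega
  · rw [kernelEntry_of_ne]
    · convert hasSum_zero with n
      rw [Pi.smul_apply, zEntry, if_neg fun h' => h ⟨n, h'⟩, smul_zero]
    · rintro n b₁ a₁ rfl
      exact h ⟨n, rfl⟩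

end Kernel

/-! ### The integral as a weighted trace, and the pairing in terms of entries. -/

section Pairing

variable (q : QParam) {Y₁ Y₂ : QSpace}

/-- The transposed matrix position. -/
def transp (x : ℤ × ℤ × ℤ) : ℤ × ℤ × ℤ := (x.2.1, x.1, -x.2.2)

theorem transp_sub_colV (g : Gen) (x : ℤ × ℤ × ℤ) : transp (x - colV g) = transp x + rowV g := by
  obtain ⟨a, b, d⟩ := x
  cases g <;> simp [transp, colV, rowV] <;> ring

theorem transp_sub_rowV (g : Gen) (x : ℤ × ℤ × ℤ) : transp (x - rowV g) = transp x + colV g := by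
  obtain ⟨a, b, d⟩ := x
  cases g <;> simp [transp, colV, rowV] <;> ring

/-- The trace property at the level of generators: a column shift applied to a unit function has the
same weight as a row shift at the transposed position. -/
theorem colC_sub_colV (Y : QSpace) (g : Gen) (x : ℤ × ℤ × ℤ) :
    colC q Y g (x - colV g) = rowC q Y g (transp x) := by
  obtain ⟨a, b, d⟩ := x
  cases g <;> simp [transp, colV, rowC, colC]

theorem rowC_sub_rowV (Y : QSpace) (g : Gen) (x : ℤ × ℤ × ℤ) :
    rowC q Y g (x - rowV g) = colC q Y g (transp x) := by
  obtain ⟨a, b, d⟩ := x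
  cases g <;> simp [transp, rowV, rowC, colC]

/-- The position of the entry of a distribution that is paired with a given entry of a finite
function. -/
def dualPosition (x : Position) : Position := (transp x.1, transp x.2)

theorem dualPosition_mem {x : Position} :
    dualPosition x ∈ specPosition Y₁ Y₂ ↔ x ∈ specPosition Y₁ Y₂ := by
  obtain ⟨⟨a, b, d⟩, a', b', d'⟩ := x
  simp only [dualPosition, transp, mem_specPosition_iff]
  tauto

theorem dualPosition_dualPosition (x : Position) : dualPosition (dualPosition x) = x := by
  simp [dualPosition, transp]

/-- The finite function with one nonzero matrix entry. -/
noncomputable def unitDist (x : Position) : Dist Y₁ Y₂ := ofEntry q (Pi.single x 1)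

theorem unitDist_eq_zero {x : Position} (hx : x ∉ specPosition Y₁ Y₂) :
    (unitDist q x : Dist Y₁ Y₂) = 0 := by
  funext u
  rw [unitDist, ofEntry_apply, Pi.single_eq_of_ne, mul_zero]
  · rfl
  · rintro rfl
    exact hx (position_mem u)

open Classical in
theorem unitDist_position (u : (MIdx × Y₁.Spec) × (MIdx × Y₂.Spec)) :
    unitDist q (position Y₁ Y₂ u) = Pi.single u (weight q u)⁻¹ := by
  funext v
  rw [unitDist, ofEntry_apply]
  by_cases h : v = u
  · subst h
    simp
  · rw [Pi.single_eq_of_ne h, Pi.single_eq_of_ne (position_injective.ne h), mul_zero]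

theorem wshift_unitDist (c : Position → ℂ) (v x : Position)
    (hx : x ∈ specPosition Y₁ Y₂) :
    wshift q c v (unitDist q x : Dist Y₁ Y₂) = c (x - v) • unitDist q (x - v) := by
  refine entry_ext q fun y hy => ?_
  rw [entry_wshift q _ _ _ hy, map_smul, Pi.smul_apply, unitDist, unitDist, entry_ofEntry q _ hy,
    smul_eq_mul]
  by_cases h : y = x - v
  · rw [h, sub_add_cancel, entry_ofEntry q _ hx]
    simp
  · rw [Pi.single_eq_of_ne h, mul_zero]
    by_cases hy' : y + v ∈ specPosition Y₁ Y₂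
    · rw [entry_ofEntry q _ hy', Pi.single_eq_of_ne, mul_zero]
      exact fun h' => h (eq_sub_of_add_eq h')
    · rw [entry_eq_zero q _ hy', mul_zero]

theorem IsFiniteFunction.add {ψ φ : Dist Y₁ Y₂} (hψ : IsFiniteFunction ψ)
    (hφ : IsFiniteFunction φ) : IsFiniteFunction (ψ + φ) :=
  (hψ.union hφ).subset (Function.support_add ψ φ)

theorem IsFiniteFunction.smul {ψ : Dist Y₁ Y₂} (r : ℂ) (hψ : IsFiniteFunction ψ) :
    IsFiniteFunction (r • ψ) :=
  hψ.subset (Function.support_const_smul_subset r ψ)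

theorem isFiniteFunction_zero : IsFiniteFunction (0 : Dist Y₁ Y₂) := by
  simp [IsFiniteFunction]

theorem isFiniteFunction_unitDist (x : Position) :
    IsFiniteFunction (unitDist q x : Dist Y₁ Y₂) := by
  by_cases hx : x ∈ specPosition Y₁ Y₂
  · obtain ⟨u, rfl⟩ := exists_position_eq hx
    classical
    rw [unitDist_position]
    exact (Set.finite_singleton u).subset Pi.support_single_subset
  · rw [unitDist_eq_zero q hx]
    exact isFiniteFunction_zero

theorem integral_smul (r : ℂ) (ψ : Dist Y₁ Y₂) : integral q (r • ψ) = r * integral q ψ := by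
  simp only [integral, Pi.smul_apply, smul_eq_mul, mul_assoc, ← mul_finsum]
  rw [mul_left_comm]

theorem integral_zero : integral q (0 : Dist Y₁ Y₂) = 0 := by
  simp [integral]

theorem integral_add {ψ φ : Dist Y₁ Y₂} (hψ : IsFiniteFunction ψ) (hφ : IsFiniteFunction φ) :
    integral q (ψ + φ) = integral q ψ + integral q φ := by
  have fin : ∀ {ψ : Dist Y₁ Y₂}, IsFiniteFunction ψ → (Function.support
      fun m : Y₁.Spec × Y₂.Spec => ψ ((MIdx.zero, m.1), (MIdx.zero, m.2)) *
        q.c ^ (-2 * (m.1 : ℤ)) * q.c ^ (-2 * (m.2 : ℤ))).Finite := by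
    intro ψ hψ
    have hinj : Function.Injective fun m : Y₁.Spec × Y₂.Spec =>
        (((MIdx.zero, m.1), (MIdx.zero, m.2)) : (MIdx × Y₁.Spec) × (MIdx × Y₂.Spec)) := by
      intro m n h
      simp only [Prod.mk.injEq, true_and] at h
      exact Prod.ext h.1 h.2
    refine (hψ.preimage hinj.injOn).subset fun m hm h => hm ?_
    simp only [] at h ⊢
    rw [h, zero_mul, zero_mul]
  simp only [integral, Pi.add_apply, add_mul]
  rw [finsum_add_distrib (fin hψ) (fin hφ), mul_add]

theorem integral_unitDist {x : Position} (hx : x ∈ specPosition Y₁ Y₂) :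
    integral q (unitDist q x : Dist Y₁ Y₂) = (1 - q.c ^ 2) ^ 2 * q.c ^ (-2 * x.1.1) *
      q.c ^ (-2 * x.2.2.1) * entry q (one q Y₁ Y₂) (dualPosition x) := by
  obtain ⟨⟨a, b, d⟩, a', b', d'⟩ := x
  have hone : entry q (one q Y₁ Y₂) (dualPosition ((a, b, d), (a', b', d'))) =
      if b = a ∧ -d = 0 ∧ b' = a' ∧ -d' = 0 then 1 else 0 :=
    entry_one q (x := ((b, a, -d), (b', a', -d'))) (dualPosition_mem.2 hx)
  rw [hone]
  have hpos : ∀ m : Y₁.Spec × Y₂.Spec, position Y₁ Y₂ ((MIdx.zero, m.1), (MIdx.zero, m.2)) =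
      (((m.1 : ℤ), (m.1 : ℤ), 0), ((m.2 : ℤ), (m.2 : ℤ), 0)) := fun m => by
    simp [position, pos, MIdx.zero]
  have hwt : ∀ m : Y₁.Spec × Y₂.Spec, weight q ((MIdx.zero, m.1), (MIdx.zero, m.2)) = 1 :=
    fun m => by simp [weight, wt, MIdx.zero]
  rw [integral, mul_assoc, mul_assoc]
  congr 1
  simp only [unitDist, ofEntry_apply, hpos, hwt, inv_one, one_mul]
  by_cases h : b = a ∧ -d = 0 ∧ b' = a' ∧ -d' = 0
  · rw [if_pos h]
    obtain ⟨rfl, hd, rfl, hd'⟩ := h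
    obtain rfl := neg_eq_zero.1 hd
    obtain rfl := neg_eq_zero.1 hd'
    rw [finsum_eq_single _ (⟨b, fun h => (hx.1 h).1⟩, ⟨b', fun h => (hx.2 h).1⟩)]
    · simp
    · intro m hm
      rw [Pi.single_eq_of_ne, zero_mul, zero_mul]
      intro h
      simp only [Prod.mk.injEq, and_true, and_self] at h
      exact hm (Prod.ext (Subtype.ext h.1) (Subtype.ext h.2))
  · rw [if_neg h, mul_zero, mul_zero]
    refine (finsum_congr fun m => ?_).trans finsum_zero
    rw [Pi.single_eq_of_ne, zero_mul, zero_mul]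
    intro h'
    simp only [Prod.mk.injEq] at h'
    omega

/-- The ratio of the integral of the product and the product of paired entries. -/
noncomputable def density (x : Position) : ℂ :=
  (1 - q.c ^ 2) ^ 2 * q.c ^ (-2 * x.1.1) * q.c ^ (-2 * x.2.2.1)

theorem density_ne_zero (x : Position) : density q x ≠ 0 :=
  mul_ne_zero (mul_ne_zero (pow_ne_zero _ (sub_ne_zero.2 (q.c_pow_ne_one 2 two_ne_zero).symm))
    (zpow_ne_zero _ q.c_ne_zero)) (zpow_ne_zero _ q.c_ne_zero)

theorem leftMul_zero_right (K : PolProd q Y₁ Y₂) : leftMul q K (0 : Dist Y₁ Y₂) = 0 := by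
  simpa using leftMul_smul_right q K 0 0

/-- Polynomials act on unit finite functions by finite functions whose integrals are entries. -/
theorem integral_leftMul_unitDist (p : PolProd q Y₁ Y₂) (x : Position) :
    IsFiniteFunction (leftMul q p (unitDist q x : Dist Y₁ Y₂)) ∧
      integral q (leftMul q p (unitDist q x : Dist Y₁ Y₂)) =
        density q x * entry q (toDist q Y₁ Y₂ p) (dualPosition x) := by
  -- The formula is required at all positions x simultaneously, because appending a generator to p
  -- moves the position.
  let S : Submodule ℂ (PolProd q Y₁ Y₂) :=
    { carrier := {p | ∀ x, IsFiniteFunction (leftMul q p (unitDist q x : Dist Y₁ Y₂)) ∧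
        integral q (leftMul q p (unitDist q x : Dist Y₁ Y₂)) =
          density q x * entry q (toDist q Y₁ Y₂ p) (dualPosition x)}
      zero_mem' := fun x => by
        have h : leftMul q (0 : PolProd q Y₁ Y₂) = (0 : Dist Y₁ Y₂ → Dist Y₁ Y₂) := by
          simpa using leftMul_smul q 0 (0 : PolProd q Y₁ Y₂)
        simp only [h, Pi.zero_apply, map_zero, integral_zero, mul_zero, and_true]
        exact isFiniteFunction_zero
      add_mem' := fun {a b} ha hb x => by
        rw [leftMul_add, Pi.add_apply, integral_add q (ha x).1 (hb x).1, (ha x).2, (hb x).2,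
          map_add, map_add, Pi.add_apply, mul_add]
        exact ⟨(ha x).1.add (hb x).1, rfl⟩
      smul_mem' := fun r a ha x => by
        rw [leftMul_smul, Pi.smul_apply, integral_smul, (ha x).2, map_smul, map_smul,
          Pi.smul_apply, smul_eq_mul, mul_left_comm]
        exact ⟨(ha x).1.smul r, rfl⟩ }
  have h1 : (1 : PolProd q Y₁ Y₂) ∈ S := fun x => by
    rw [leftMul_one, id]
    refine ⟨isFiniteFunction_unitDist q x, ?_⟩
    by_cases hx : x ∈ specPosition Y₁ Y₂
    · exact integral_unitDist q hx
    · rw [unitDist_eq_zero q hx, integral_zero, entry_eq_zero, mul_zero]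
      rwa [dualPosition_mem]
  have step : ∀ (s k : PolProd q Y₁ Y₂) (r : Position → ℂ) (v : Position), s ∈ S →
      (∀ x ∈ specPosition Y₁ Y₂, leftMul q k (unitDist q x : Dist Y₁ Y₂) =
        r x • unitDist q (x - v)) →
      (∀ x ∈ specPosition Y₁ Y₂, density q (x - v) = density q x ∧
        entry q (toDist q Y₁ Y₂ (s * k)) (dualPosition x) =
          r x * entry q (toDist q Y₁ Y₂ s) (dualPosition (x - v))) → s * k ∈ S := by
    intro s k r v hs hk hd x
    by_cases hx : x ∈ specPosition Y₁ Y₂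
    · rw [leftMul_mul, Function.comp_apply, hk x hx, leftMul_smul_right, integral_smul,
        (hs _).2, (hd x hx).1, (hd x hx).2, mul_left_comm]
      exact ⟨(hs _).1.smul _, rfl⟩
    · rw [unitDist_eq_zero q hx, leftMul_zero_right, integral_zero, entry_eq_zero, mul_zero]
      · exact ⟨isFiniteFunction_zero, rfl⟩
      · rwa [dualPosition_mem]
  -- Right multipliers preserving `S` form a subalgebra. Once it contains the generators it is
  -- everything, and 1 ∈ `S` then gives every p.
  let T : Subalgebra ℂ (PolProd q Y₁ Y₂) :=
    { carrier := {k | ∀ s ∈ S, s * k ∈ S}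
      mul_mem' := fun {a b} ha hb s hs => by rw [← mul_assoc]; exact hb _ (ha s hs)
      add_mem' := fun {a b} ha hb s hs => by rw [mul_add]; exact S.add_mem (ha s hs) (hb s hs)
      algebraMap_mem' := fun r s hs => by
        rw [← Algebra.commutes, ← Algebra.smul_def]; exact S.smul_mem r hs }
  have hT : T = ⊤ := by
    refine subalgebra_eq_top q T (fun g s hs => ?_) fun g s hs => ?_
    · refine step s _ (fun x => colC q Y₁ g (x.1 - colV g)) (colV g, 0) hs (fun x hx => ?_)
        fun x hx => ⟨?_, ?_⟩
      · rw [leftMul_t, leftT, wshift_unitDist q _ _ _ hx]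
        rfl
      -- The density depends only on the row in the first factor and the column in the second, and
      -- left multiplications move neither.
      · simp only [density, Prod.fst_sub, Prod.snd_sub, sub_zero]
        cases g <;> simp [colV]
      · rw [← rightMul_toDist, entry_rightMul_t q _ _ (dualPosition_mem.2 hx), colC_sub_colV]
        congr 2
        simp only [dualPosition, Prod.fst_sub, Prod.snd_sub, sub_zero, transp_sub_colV,
          Prod.mk_add_mk, add_zero]
    · refine step s _ (fun x => rowC q Y₂ g (x.2 - rowV g)) (0, rowV g) hs (fun x hx => ?_)
        fun x hx => ⟨?_, ?_⟩
      · rw [leftMul_tau, leftTau, wshift_unitDist q _ _ _ hx]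
        rfl
      · simp only [density, Prod.fst_sub, Prod.snd_sub, sub_zero]
        cases g <;> simp [rowV]
      · rw [← rightMul_toDist, entry_rightMul_tau q _ _ (dualPosition_mem.2 hx), rowC_sub_rowV]
        congr 2
        simp only [dualPosition, Prod.fst_sub, Prod.snd_sub, sub_zero, transp_sub_rowV,
          Prod.mk_add_mk, add_zero]
  have : p ∈ T := hT ▸ Algebra.mem_top
  have := this 1 h1
  rw [one_mul] at this
  exact this x

theorem eq_sum_unitDist {ψ : Dist Y₁ Y₂} (hψ : (Function.support ψ).Finite) :
    ψ = ∑ u ∈ hψ.toFinset, (ψ u * weight q u) • unitDist q (position Y₁ Y₂ u) := by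
  classical
  funext v
  rw [Finset.sum_apply]
  simp only [unitDist_position, Pi.smul_apply, smul_eq_mul, Pi.single_apply, mul_ite, mul_zero,
    Finset.sum_ite_eq]
  split_ifs with h
  · rw [mul_assoc, mul_inv_cancel₀ (weight_ne_zero q v), mul_one]
  · simpa using h

theorem integral_leftMul_sum {ι : Type*} (p : PolProd q Y₁ Y₂) (I : Finset ι) (r : ι → ℂ)
    (x : ι → Position) :
    IsFiniteFunction (leftMul q p (∑ u ∈ I, r u • unitDist q (x u) : Dist Y₁ Y₂)) ∧
      integral q (leftMul q p (∑ u ∈ I, r u • unitDist q (x u) : Dist Y₁ Y₂)) =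
        ∑ u ∈ I, r u * density q (x u) * entry q (toDist q Y₁ Y₂ p) (dualPosition (x u)) := by
  classical
  induction I using Finset.induction_on with
  | empty =>
    simp only [Finset.sum_empty, leftMul_zero_right, integral_zero, and_true]
    exact isFiniteFunction_zero
  | insert u I hu ih =>
    have h := integral_leftMul_unitDist q p (x u)
    rw [Finset.sum_insert hu, Finset.sum_insert hu, leftMul_add_right, leftMul_smul_right,
      integral_add q (h.1.smul _) ih.1, integral_smul, h.2, ih.2, mul_assoc]
    exact ⟨(h.1.smul _).add ih.1, rfl⟩

/-- The right-hand side is continuous in `F` and agrees with the integral on polynomials, hence it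
is the extension by continuity. -/
theorem pairing_sum {ι : Type*} (F : Dist Y₁ Y₂) (I : Finset ι) (r : ι → ℂ) (x : ι → Position) :
    pairing q F (∑ u ∈ I, r u • unitDist q (x u)) =
      ∑ u ∈ I, r u * density q (x u) * entry q F (dualPosition (x u)) := by
  refine limUnder_toDist q (Φ := fun F : Dist Y₁ Y₂ => ∑ u ∈ I, r u * density q (x u) *
    entry q F (dualPosition (x u))) ?_ (fun p => (integral_leftMul_sum q p I r x).2) F
  refine continuous_finsetSum _ fun u _ => continuous_const.mul ?_
  exact (continuous_apply _).comp (entry q).continuous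

theorem pairing_unitDist (F : Dist Y₁ Y₂) (x : Position) :
    pairing q F (unitDist q x) = density q x * entry q F (dualPosition x) := by
  have := pairing_sum q F {()} (fun _ => 1) fun _ => x
  simpa using this

/-- The unit function at the transposed position isolates a single entry, with nonzero density. -/
theorem pairing_separates {F G : Dist Y₁ Y₂}
    (h : ∀ ψ, IsFiniteFunction ψ → pairing q F ψ = pairing q G ψ) : F = G := by
  refine entry_ext q fun x _ => ?_
  have := h _ (isFiniteFunction_unitDist q (dualPosition x))
  rw [pairing_unitDist, pairing_unitDist, dualPosition_dualPosition] at this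
  exact mul_left_cancel₀ (density_ne_zero q _) this

end Pairing

/-! ### Polynomial vector-functions and uniqueness. -/

section PolynomialVF

variable (q : QParam) {Y₁ Y₂ : QSpace}

theorem smeval_eq_eval₂ (P : LaurentPolynomial ℂ) (lam : ℂˣ) :
    P.smeval lam = LaurentPolynomial.eval₂ (RingHom.id ℂ) lam P := by
  induction P using LaurentPolynomial.induction_on' with
  | add f g hf hg => rw [LaurentPolynomial.smeval_add, hf, hg, map_add]
  | C_mul_T n a => rw [LaurentPolynomial.smeval_C_mul_T_n, LaurentPolynomial.eval₂_C_mul_T]; rfl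

theorem smeval_toLaurent (P : ℂ[X]) (lam : ℂˣ) :
    (Polynomial.toLaurent P).smeval lam = P.eval (lam : ℂ) := by
  rw [smeval_eq_eval₂, LaurentPolynomial.eval₂_toLaurent]
  rfl

/-- A Laurent polynomial is determined by its values at infinitely many points. -/
theorem laurent_eq_of_infinite {P Q : LaurentPolynomial ℂ} {s : Set ℂˣ} (hs : s.Infinite)
    (h : ∀ lam ∈ s, P.smeval lam = Q.smeval lam) : P = Q := by
  -- Multiplying by a power of λ clears the negative exponents and reduces the claim to an ordinary
  -- polynomial with infinitely many roots.
  obtain ⟨n, R, hR⟩ := LaurentPolynomial.exists_T_pow (P - Q)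
  have h0 : R = 0 := by
    refine Polynomial.eq_zero_of_infinite_isRoot _
      ((hs.image Units.val_injective.injOn).mono ?_)
    rintro _ ⟨lam, hlam, rfl⟩
    change R.eval (lam : ℂ) = 0
    have := h lam hlam
    rw [smeval_eq_eval₂, smeval_eq_eval₂] at this
    rw [← smeval_toLaurent, smeval_eq_eval₂, hR, map_mul, map_sub, this, sub_self, zero_mul]
  rw [h0, map_zero] at hR
  have := congrArg (· * LaurentPolynomial.T (-n : ℤ)) hR
  simp only [zero_mul, mul_assoc, ← LaurentPolynomial.T_add, add_neg_cancel,
    LaurentPolynomial.T_zero, mul_one] at this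
  exact sub_eq_zero.1 this.symm

theorem infinite_range_qPt : (Set.range (qPt q)).Infinite := by
  refine Set.infinite_range_of_injective fun l k h => ?_
  have h' := congrArg (fun u : ℂˣ => (u : ℂ)) h
  simp only [qPt, Units.val_pow_eq_pow_val, Units.val_mk0, QParam.c, ← Complex.ofReal_pow,
    Complex.ofReal_inj] at h'
  have := pow_right_injective₀ q.pos q.lt_one.ne h'
  omega

theorem qPt_val (l : ℕ) : ((qPt q l : ℂˣ) : ℂ) = q.c ^ (2 * l) := by
  simp [qPt]

/-- Polynomial vector-functions are determined by their values at the points `q^{2l}`. -/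
theorem IsPolynomialVF.ext {f g : ℂˣ → Dist Y₁ Y₂} (hf : IsPolynomialVF q f)
    (hg : IsPolynomialVF q g) (h : ∀ l, f (qPt q l) = g (qPt q l)) : f = g := by
  funext lam
  refine pairing_separates q fun ψ hψ => ?_
  obtain ⟨P, hP⟩ := hf ψ hψ
  obtain ⟨Q, hQ⟩ := hg ψ hψ
  rw [hP, hQ, laurent_eq_of_infinite (P := P) (Q := Q) (infinite_range_qPt q)]
  rintro _ ⟨l, rfl⟩
  rw [← hP, ← hQ, h]

theorem exists_eval_qPoch (n : ℕ) : ∃ P : ℂ[X], ∀ lam, P.eval lam = qPoch q lam n :=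
  ⟨∏ j ∈ Finset.range n, (1 - X * C (q.c ^ (2 * j))), fun lam => by
    simp [qPoch, Polynomial.eval_prod]⟩

/-- A position lies on at most one diagonal, so its entry is a constant times a single (λ; q²)_n. -/
theorem exists_eval_entry_kernelDist (x : Position) :
    ∃ P : ℂ[X], ∀ lam, P.eval lam = entry q (kernelDist q Y₁ Y₂ 0 lam) x := by
  by_cases hx : x ∈ specPosition Y₁ Y₂
  · by_cases h : ∃ n b a', x = diag 0 n b a'
    · obtain ⟨n, b, a', rfl⟩ := h
      obtain ⟨P, hP⟩ := exists_eval_qPoch q n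
      refine ⟨C ((qPoch q (q.c ^ 2) n)⁻¹ * zProd q Y₂ n b a') * P, fun lam => ?_⟩
      rw [kernelDist, entry_ofEntry q _ hx, kernelEntry_diag, eval_mul, eval_C, hP]
      ring
    · refine ⟨0, fun lam => ?_⟩
      rw [kernelDist, entry_ofEntry q _ hx, kernelEntry_of_ne, eval_zero]
      exact fun n b a' h' => h ⟨n, b, a', h'⟩
  · exact ⟨0, fun lam => by rw [entry_eq_zero q _ hx, eval_zero]⟩

theorem isPolynomialVF_kernelDist :
    IsPolynomialVF q fun lam : ℂˣ => kernelDist q Y₁ Y₂ 0 lam := by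
  intro ψ (hψ : (Function.support ψ).Finite)
  choose P hP using exists_eval_entry_kernelDist q (Y₁ := Y₁) (Y₂ := Y₂)
  refine ⟨Polynomial.toLaurent (∑ u ∈ hψ.toFinset, C (ψ u * weight q u *
    density q (position Y₁ Y₂ u)) * P (dualPosition (position Y₁ Y₂ u))), fun lam => ?_⟩
  rw [smeval_toLaurent, Polynomial.eval_finsetSum]
  simp only [eval_mul, eval_C, hP]
  conv_lhs => rw [eq_sum_unitDist q hψ]
  exact pairing_sum q _ _ _ _

end PolynomialVF

end QSU

theorem proposition6p9 (q : QSU.QParam) (Y₁ Y₂ : QSU.QSpace)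
    (hY : Y₁ = QSU.QSpace.principal ∨ Y₂ = QSU.QSpace.principal) :
    -- the elements inverted below act bijectively on distributions
    Function.Bijective (QSU.leftMul q (QSU.t q Y₁ Y₂ .t12)) ∧
    Function.Bijective (QSU.leftMul q (QSU.tau q Y₁ Y₂ .t21)) ∧
    (∀ l : ℕ, Function.Bijective (QSU.leftMul q (QSU.lead q Y₁ Y₂ ^ l))) ∧
    -- `kinv l` is the unique inverse of `k₁₁ ^ l`, that is, `k₁₁ ^ (-l)`
    ∃ kinv : ℕ → QSU.Dist Y₁ Y₂,
      (∀ (l : ℕ) (g : QSU.Dist Y₁ Y₂), QSU.IsInverse q (QSU.k11 q Y₁ Y₂ ^ l) g ↔ g = kinv l) ∧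
      ∃ f : ℂˣ → QSU.Dist Y₁ Y₂,
        (QSU.IsPolynomialVF q f ∧
          ∀ l : ℕ, kinv l = QSU.leftDiv q (QSU.lead q Y₁ Y₂ ^ l) (f (QSU.qPt q l))) ∧
        (∀ f' : ℂˣ → QSU.Dist Y₁ Y₂,
          (QSU.IsPolynomialVF q f' ∧
            ∀ l : ℕ, kinv l = QSU.leftDiv q (QSU.lead q Y₁ Y₂ ^ l) (f' (QSU.qPt q l))) →
          f' = f) ∧
        ∀ lam : ℂˣ, HasSum
          (fun n : ℕ => (QSU.qPoch q lam n / QSU.qPoch q (q.c ^ 2) n) • QSU.zZetaPow q Y₁ Y₂ n)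
          (f lam) := by
  refine ⟨QSU.bijective_t12 q, QSU.bijective_tau21 q, QSU.bijective_lead_pow q,
    fun l => QSU.kernelDist q Y₁ Y₂ l (q.c ^ (2 * l)), QSU.isInverse_iff q hY,
    fun lam => QSU.kernelDist q Y₁ Y₂ 0 lam, ?_, ?_, fun lam => QSU.hasSum_kernelDist q lam⟩
  · refine ⟨QSU.isPolynomialVF_kernelDist q, fun l => ?_⟩
    simp only [QSU.leftDiv_eq_iff q (QSU.bijective_lead_pow q l), QSU.leftMul_lead_pow_kernelDist,
      QSU.qPt_val]
  · rintro f' ⟨hf', h⟩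
    refine hf'.ext q (QSU.isPolynomialVF_kernelDist q) fun l => ?_
    have := (QSU.leftDiv_eq_iff q (QSU.bijective_lead_pow q l) _ _).1 (h l)
    simp only [← this, QSU.leftMul_lead_pow_kernelDist, QSU.qPt_val]
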